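/- Let $d\in\{1,2,3\}$, let $\Omega\subset\mathbb R^d$ be a bounded open set, $T>0$, $Q=\Omega\times(0,T)$, $\Sigma=\partial\Omega\times(0,T)$, $\omega=2\pi/T$, and let $\|\cdot\|$ denote the norm of $L^2(Q)$ (or $L^2(Q)^d$). Let $\sigma,\nu:\Omega\to\mathbb R$ be measurable with $0<\underline\sigma\le\sigma\le\overline\sigma$ and $0<\underline\nu\le\nu\le\overline\nu$ on $\Omega$, put $\underline{\mu_1}=\frac1{\sqrt2}\min\{\underline\nu,\underline\sigma\}$, and let $C_F$ be Friedrichs' constant of $\Omega$, the smallest constant with $\|u\|_{L^2(\Omega)}\le C_F\|\nabla u\|_{L^2(\Omega)}$ for all $u\in H^1_0(\Omega)$. Here $\nabla$ and $\nabla\cdot$ act on the spatial variable only. $H^{1,0}_0(Q)$ is the space of $u\in L^2(Q)$ with weak gradient $\nabla u\in L^2(Q)^d$ and $u=0$ on $\Sigma$ (that is, in the closure, for the norm $(\|u\|^2+\|\nabla u\|^2)^{1/2}$, of the restrictions to $Q$ of the functions in $C_c^\infty(\Omega\times\mathbb R)$). $H^{1,1}_{0,per}(Q)$ is the space of $u\in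 H^{1,0}_0(Q)$ with weak time derivative $\partial_tu\in L^2(Q)$ and $u(0)=u(T)$ in the sense of $L^2(\Omega)$-traces. For $u\in L^2(Q)$ and $k\ge1$ let $u_k^c(x)=\frac2T\int_0^Tu(x,t)\cos(k\omega t)\,dt$ and $u_k^s(x)=\frac2T\int_0^Tu(x,t)\sin(k\omega t)\,dt$. $H^{1,1/2}_{0,per}(Q)$ is the space of $u\in H^{1,0}_0(Q)$ with $\frac T2\sum_{k\ge1}k\omega\int_\Omega\big((u_k^c)^2+(u_k^s)^2\big)dx<\infty$, and for $u,v$ in it $$\langle\sigma\partial_t^{1/2}u,\partial_t^{1/2}v^\perp\rangle:=\frac T2\sum_{k\ge1}k\omega\int_\Omega\sigma\,\big(-u_k^cv_k^s+u_k^sv_k^c\big)\,dx .$$ $H(\mathrm{div},Q)$ is the space of $\rho\in L^2(Q)^d$ such that $\nabla\cdot\rho(\cdot,t)\in L^2(\Omega)$ in the weak sense for a.e. $t\in(0,T)$. Let $y_d\in L^2(Q)$ and $\eta\in H^{1,1}_{0,per}(Q)$, and let $p_\eta\in H^{1,1/2}_{0,per}(Q)$ satisfy $$\int_Q\nu\nabla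 p_\eta\cdot\nabla z\,dx\,dt-\langle\sigma\partial_t^{1/2}p_\eta,\partial_t^{1/2}z^\perp\rangle=\int_Q(\eta-y_d)\,z\,dx\,dt\qquad\text{for all }z\in H^{1,1/2}_{0,per}(Q).$$ Then, for every $\zeta\in H^{1,1}_{0,per}(Q)$ and every $\rho\in H(\mathrm{div},Q)$, $$\|\nabla(p_\eta-\zeta)\|\le\frac1{\underline{\mu_1}}\big(C_F\,\|\mathcal R_3(\zeta,\rho,\eta)\|+\|\mathcal R_4(\zeta,\rho)\|\big),$$ where $\mathcal R_3(\zeta,\rho,\eta)=\eta-y_d+\nabla\cdot\rho+\sigma\partial_t\zeta$ and $\mathcal R_4(\zeta,\rho)=\rho-\nu\nabla\zeta$ (the right-hand side is $+\infty$ if $\mathcal R_3(\zeta,\rho,\eta)\notin L^2(Q)$ and $\Omega\neq\emptyset$). -/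

import Mathlib

open MeasureTheory Filter Topology Set
open scoped ContDiff ENNReal

noncomputable section

namespace TimePeriodic

/-- The Euclidean space `ℝ^d` of the spatial variable. -/
abbrev Sp (d : ℕ) : Type := EuclideanSpace ℝ (Fin d)

/-- The space-time cylinder `Q = Ω × (0,T)`. -/
def cyl {d : ℕ} (Ω : Set (Sp d)) (T : ℝ) : Set (Sp d × ℝ) := Ω ×ˢ Ioo 0 T

/-- Lebesgue measure on `Ω`. -/
abbrev muO {d : ℕ} (Ω : Set (Sp d)) : Measure (Sp d) := volume.restrict Ω

/-- Lebesgue measure on `Q`. -/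
abbrev muQ {d : ℕ} (Ω : Set (Sp d)) (T : ℝ) : Measure (Sp d × ℝ) :=
  volume.restrict (cyl Ω T)

/-- `φ ∈ C_c^∞(U)`. -/
def IsTest {X : Type*} [NormedAddCommGroup X] [NormedSpace ℝ X] (U : Set X) (φ : X → ℝ) : Prop :=
  ContDiff ℝ ∞ φ ∧ HasCompactSupport φ ∧ tsupport φ ⊆ U

/-- Classical spatial gradient of a function on space-time. -/
def gradX {d : ℕ} (φ : Sp d × ℝ → ℝ) (z : Sp d × ℝ) : Sp d :=
  gradient (fun x => φ (x, z.2)) z.1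

/-- Classical time derivative of a function on space-time. -/
def dT {d : ℕ} (φ : Sp d × ℝ → ℝ) (z : Sp d × ℝ) : ℝ :=
  deriv (fun s => φ (z.1, s)) z.2

/-! ### Spaces on `Ω` -/

/-- `u ∈ H^1_0(Ω)` with weak gradient `G`: the closure of `C_c^∞(Ω)` in the `H^1`-norm. -/
structure MemH1Zero {d : ℕ} (Ω : Set (Sp d)) (u : Sp d → ℝ) (G : Sp d → Sp d) : Prop where
  memLp : MemLp u 2 (muO Ω)
  grad_memLp : MemLp G 2 (muO Ω)
  approx : ∃ φ : ℕ → Sp d → ℝ, (∀ n, IsTest Ω (φ n)) ∧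
    Tendsto (fun n => eLpNorm (fun x => φ n x - u x) 2 (muO Ω)) atTop (𝓝 0) ∧
    Tendsto (fun n => eLpNorm (fun x => gradient (φ n) x - G x) 2 (muO Ω)) atTop (𝓝 0)

/-- Friedrichs' constant of `Ω`: the smallest `C ≥ 0` such that
`‖u‖_Ω ≤ C ‖∇u‖_Ω` for all `u ∈ H^1_0(Ω)`. -/
def friedrichsConst {d : ℕ} (Ω : Set (Sp d)) : ℝ :=
  sInf {C : ℝ | 0 ≤ C ∧ ∀ (u : Sp d → ℝ) (G : Sp d → Sp d), MemH1Zero Ω u G →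
    eLpNorm u 2 (muO Ω) ≤ ENNReal.ofReal C * eLpNorm G 2 (muO Ω)}

/-! ### Spaces on `Q` -/

/-- `u ∈ H^{1,0}(Q)` with weak spatial gradient `G`. -/
structure MemH10 {d : ℕ} (Ω : Set (Sp d)) (T : ℝ)
    (u : Sp d × ℝ → ℝ) (G : Sp d × ℝ → Sp d) : Prop where
  memLp : MemLp u 2 (muQ Ω T)
  grad_memLp : MemLp G 2 (muQ Ω T)
  weak_grad : ∀ φ : Sp d × ℝ → ℝ, IsTest (cyl Ω T) φ →
    ∫ z, u z • gradX φ z ∂(muQ Ω T) = -∫ z, φ z • G z ∂(muQ Ω T)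

/-- `u ∈ H^{1,0}_0(Q)` with weak spatial gradient `G`. The condition `u = 0` on `Σ = ∂Ω × (0,T)`
is read as membership in the closure, in the norm of `H^{1,0}(Q)`, of the smooth functions that
vanish near the lateral surface. -/
structure MemH10Zero {d : ℕ} (Ω : Set (Sp d)) (T : ℝ)
    (u : Sp d × ℝ → ℝ) (G : Sp d × ℝ → Sp d) : Prop extends MemH10 Ω T u G where
  approx : ∃ φ : ℕ → Sp d × ℝ → ℝ, (∀ n, IsTest (Ω ×ˢ univ) (φ n)) ∧
    Tendsto (fun n => eLpNorm (fun z => φ n z - u z) 2 (muQ Ω T)) atTop (𝓝 0) ∧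
    Tendsto (fun n => eLpNorm (fun z => gradX (φ n) z - G z) 2 (muQ Ω T)) atTop (𝓝 0)

/-- `u ∈ H^{0,1}(Q)` with weak time derivative `D`. -/
structure MemH01 {d : ℕ} (Ω : Set (Sp d)) (T : ℝ) (u D : Sp d × ℝ → ℝ) : Prop where
  memLp : MemLp u 2 (muQ Ω T)
  deriv_memLp : MemLp D 2 (muQ Ω T)
  weak_deriv : ∀ φ : Sp d × ℝ → ℝ, IsTest (cyl Ω T) φ →
    ∫ z, u z * dT φ z ∂(muQ Ω T) = -∫ z, D z * φ z ∂(muQ Ω T)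

/-- `a = u(0)` and `b = u(T)` are the traces in `L^2(Ω)` of `u ∈ H^{0,1}(Q)`, `D = ∂_t u`, at the
two ends of the time interval: integration by parts in time holds with these boundary values for
test functions that need not vanish at `t = 0` and `t = T`. -/
def HasTimeTraces {d : ℕ} (Ω : Set (Sp d)) (T : ℝ) (u D : Sp d × ℝ → ℝ)
    (a b : Sp d → ℝ) : Prop :=
  MemLp a 2 (muO Ω) ∧ MemLp b 2 (muO Ω) ∧
  ∀ φ : Sp d × ℝ → ℝ, IsTest (Ω ×ˢ univ) φ →
    ∫ z, u z * dT φ z ∂(muQ Ω T) + ∫ z, D z * φ z ∂(muQ Ω T)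
      = ∫ x, b x * φ (x, T) ∂(muO Ω) - ∫ x, a x * φ (x, 0) ∂(muO Ω)

/-- `u ∈ H^{0,1}_per(Q)` with weak time derivative `D`: moreover `u(0) = u(T)`. -/
structure MemH01Per {d : ℕ} (Ω : Set (Sp d)) (T : ℝ) (u D : Sp d × ℝ → ℝ) : Prop
    extends MemH01 Ω T u D where
  periodic : ∃ a b : Sp d → ℝ, HasTimeTraces Ω T u D a b ∧ a =ᵐ[muO Ω] b

/-- `u ∈ H^{1,1}_{0,per}(Q)` with `∇u = G` and `∂_t u = D`. -/
def MemH11ZeroPer {d : ℕ} (Ω : Set (Sp d)) (T : ℝ)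
    (u : Sp d × ℝ → ℝ) (G : Sp d × ℝ → Sp d) (D : Sp d × ℝ → ℝ) : Prop :=
  MemH10Zero Ω T u G ∧ MemH01Per Ω T u D

/-! ### Fourier coefficients in time, with frequency `ω = 2π/T` -/

/-- `u_k^c(x)`, `k ≥ 1`. -/
def cosCoeff {d : ℕ} (T : ℝ) (u : Sp d × ℝ → ℝ) (k : ℕ) (x : Sp d) : ℝ :=
  2 / T * ∫ t in (0 : ℝ)..T, u (x, t) * Real.cos (k * (2 * Real.pi / T) * t)

/-- `u_k^s(x)`, `k ≥ 1`. -/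
def sinCoeff {d : ℕ} (T : ℝ) (u : Sp d × ℝ → ℝ) (k : ℕ) (x : Sp d) : ℝ :=
  2 / T * ∫ t in (0 : ℝ)..T, u (x, t) * Real.sin (k * (2 * Real.pi / T) * t)

/-- `u ∈ H^{1,1/2}_{0,per}(Q)` with `∇u = G`, that is, `u ∈ H^{1,0}_0(Q)` and
`‖∂_t^{1/2} u‖² = (T/2) ∑_{k ≥ 1} k ω ‖(u_k^c, u_k^s)‖_Ω² < ∞` (the summand is `0` at `k = 0`). -/
structure MemH1HalfZeroPer {d : ℕ} (Ω : Set (Sp d)) (T : ℝ)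
    (u : Sp d × ℝ → ℝ) (G : Sp d × ℝ → Sp d) : Prop extends MemH10Zero Ω T u G where
  half_finite : Summable fun k : ℕ => (k : ℝ) * (2 * Real.pi / T) *
    ∫ x, (cosCoeff T u k x ^ 2 + sinCoeff T u k x ^ 2) ∂(muO Ω)

/-- `⟨σ ∂_t^{1/2} u, ∂_t^{1/2} v^⊥⟩ = (T/2) ∑_{k ≥ 1} k ω ⟨σ (u_k^c, u_k^s), (-v_k^s, v_k^c)⟩_Ω`
(the summand is `0` at `k = 0`). -/
def halfPerp {d : ℕ} (Ω : Set (Sp d)) (T : ℝ) (σ : Sp d → ℝ) (u v : Sp d × ℝ → ℝ) : ℝ :=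
  T / 2 * ∑' k : ℕ, (k : ℝ) * (2 * Real.pi / T) *
    ∫ x, σ x * (cosCoeff T u k x * (-sinCoeff T v k x)
      + sinCoeff T u k x * cosCoeff T v k x) ∂(muO Ω)

/-! ### The auxiliary adjoint equation and `H(div, Q)` -/

/-- `p ∈ H^{1,1/2}_{0,per}(Q)`, `∇p = Gp`, is the weak solution of the time-periodic adjoint
problem with right-hand side `f`. -/
def SolvesAdjoint {d : ℕ} (Ω : Set (Sp d)) (T : ℝ) (σ ν : Sp d → ℝ) (f : Sp d × ℝ → ℝ)
    (p : Sp d × ℝ → ℝ) (Gp : Sp d × ℝ → Sp d) : Prop :=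
  MemH1HalfZeroPer Ω T p Gp ∧
  ∀ (z : Sp d × ℝ → ℝ) (Gz : Sp d × ℝ → Sp d), MemH1HalfZeroPer Ω T z Gz →
    ∫ q, ν q.1 * inner ℝ (Gp q) (Gz q) ∂(muQ Ω T) - halfPerp Ω T σ p z
      = ∫ q, f q * z q ∂(muQ Ω T)

/-- `ρ ∈ H(div,Q)` with `∇·ρ = δ`: `ρ ∈ L^2(Q)^d`, and for a.e. `t ∈ (0,T)` the weak divergence
of `ρ(·,t)` is `δ(·,t) ∈ L^2(Ω)`. It is not required that `δ ∈ L^2(Q)`. -/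
structure MemHdiv {d : ℕ} (Ω : Set (Sp d)) (T : ℝ)
    (ρ : Sp d × ℝ → Sp d) (δ : Sp d × ℝ → ℝ) : Prop where
  memLp : MemLp ρ 2 (muQ Ω T)
  meas : AEStronglyMeasurable δ (muQ Ω T)
  weak_div : ∀ᵐ t ∂(volume.restrict (Ioo 0 T)),
    MemLp (fun x => δ (x, t)) 2 (muO Ω) ∧
    ∀ φ : Sp d → ℝ, IsTest Ω φ →
      ∫ x, δ (x, t) * φ x ∂(muO Ω) = -∫ x, inner ℝ (ρ (x, t)) (gradient φ x) ∂(muO Ω)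

/-- `μ₁ = min {ν_low, σ_low} / √2`. -/
def muLow (νlow σlow : ℝ) : ℝ := 1 / Real.sqrt 2 * min νlow σlow

/-- `R₃(ζ,ρ,η) = η - y_d + ∇·ρ + σ ∂_t ζ`, with `δ = ∇·ρ` and `Dζ = ∂_t ζ`. -/
def resR3 {d : ℕ} (σ : Sp d → ℝ) (yd η δ Dζ : Sp d × ℝ → ℝ) (q : Sp d × ℝ) : ℝ :=
  η q - yd q + δ q + σ q.1 * Dζ q

/-- `R₄(ζ,ρ) = ρ - ν ∇ζ`, with `Gζ = ∇ζ`. -/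
def resR4 {d : ℕ} (ν : Sp d → ℝ) (ρ Gζ : Sp d × ℝ → Sp d) (q : Sp d × ℝ) : Sp d :=
  ρ q - ν q.1 • Gζ q

end TimePeriodic

end

/-! The estimate is an energy argument for the error `e = p - ζ`, which lies in the half-derivative
space and is therefore an admissible test function in the adjoint equation.

The time term is the delicate one, since `p` has only half a time derivative. The weight `σ` depends
on `x` alone, so the form behind `halfPerp` is antisymmetric at each frequency and each point of
`Ω`: replacing `p = e + ζ` by `ζ` in the pairing with `e` changes nothing. The Fourier coefficients
of `∂_t ζ` are those of `ζ`, rotated and multiplied by `kω` (periodicity removes the boundary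
terms), so Parseval turns the form into `∫ σ ∂_t ζ e`. This is `halfPerp_sub_eq_integral`.

Adding `∫ δ e + ∫ ρ · ∇e = 0` (`MemHdiv.integral_mul_eq`, Green's formula, with `e = 0` on the
lateral surface) gives the identity `∫ ν |∇e|² = ∫ R₃ e + ∫ R₄ · ∇e`. Bounding `ν` below by `νlow`,
applying Cauchy–Schwarz and using Friedrichs' inequality for `e` yields the bound with constant `1 /
νlow`, which is at most `1 / μ₁`.

If `R₃` is not square integrable, the right-hand side is infinite, because Friedrichs' constant of a
nonempty open set is positive. -/

namespace TimePeriodic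

/-! ### Real Fourier series on `(0,T)`. -/

/-- Cosine coefficient of a function on `(0,T)`. -/
noncomputable def cosC (T : ℝ) (f : ℝ → ℝ) (k : ℕ) : ℝ :=
  2 / T * ∫ t in (0 : ℝ)..T, f t * Real.cos (k * (2 * Real.pi / T) * t)

/-- Sine coefficient of a function on `(0,T)`. -/
noncomputable def sinC (T : ℝ) (f : ℝ → ℝ) (k : ℕ) : ℝ :=
  2 / T * ∫ t in (0 : ℝ)..T, f t * Real.sin (k * (2 * Real.pi / T) * t)

/-- Lebesgue measure on `(0,T)`. -/
noncomputable abbrev muT (T : ℝ) : Measure ℝ := volume.restrict (Ioo 0 T)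

lemma intervalIntegral_eq_muT {T : ℝ} (hT : 0 < T) (f : ℝ → ℝ) :
    ∫ t in (0 : ℝ)..T, f t = ∫ t, f t ∂(muT T) := by
  rw [intervalIntegral.integral_of_le hT.le, integral_Ioc_eq_integral_Ioo]

lemma integrable_mul_cos {T : ℝ} {f : ℝ → ℝ} (hf : Integrable f (muT T)) (a : ℝ) :
    Integrable (fun t => f t * Real.cos (a * t)) (muT T) :=
  hf.mul_bdd (c := 1) (by fun_prop) (ae_of_all _ fun t => by
    simpa using Real.abs_cos_le_one _)

lemma integrable_mul_sin {T : ℝ} {f : ℝ → ℝ} (hf : Integrable f (muT T)) (a : ℝ) :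
    Integrable (fun t => f t * Real.sin (a * t)) (muT T) :=
  hf.mul_bdd (c := 1) (by fun_prop) (ae_of_all _ fun t => by
    simpa using Real.abs_sin_le_one _)

lemma cosC_add {T : ℝ} (hT : 0 < T) {f g : ℝ → ℝ} (hf : Integrable f (muT T))
    (hg : Integrable g (muT T)) (k : ℕ) :
    cosC T (fun t => f t + g t) k = cosC T f k + cosC T g k := by
  simp only [cosC, intervalIntegral_eq_muT hT, add_mul]
  rw [integral_add (integrable_mul_cos hf _) (integrable_mul_cos hg _)]
  ring

lemma sinC_add {T : ℝ} (hT : 0 < T) {f g : ℝ → ℝ} (hf : Integrable f (muT T))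
    (hg : Integrable g (muT T)) (k : ℕ) :
    sinC T (fun t => f t + g t) k = sinC T f k + sinC T g k := by
  simp only [sinC, intervalIntegral_eq_muT hT, add_mul]
  rw [integral_add (integrable_mul_sin hf _) (integrable_mul_sin hg _)]
  ring

/-- Separating real and imaginary parts lets the complex Parseval identity be read as one for the
sine and cosine coefficients. -/
lemma fourierCoeffOn_ofReal {T : ℝ} (hT : 0 < T) {f : ℝ → ℝ} (hf : Integrable f (muT T))
    (n : ℤ) : fourierCoeffOn hT (fun t => (f t : ℂ)) n
      = ((1 / T * ∫ t, f t * Real.cos (n * (2 * Real.pi / T) * t) ∂(muT T) : ℝ) : ℂ)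
        - ((1 / T * ∫ t, f t * Real.sin (n * (2 * Real.pi / T) * t) ∂(muT T) : ℝ) : ℂ)
          * Complex.I := by
  rw [fourierCoeffOn_eq_integral, intervalIntegral.integral_of_le hT.le,
    integral_Ioc_eq_integral_Ioo]
  have h : ∀ t : ℝ, (fourier (-n) (t : AddCircle (T - 0)) : ℂ) • (f t : ℂ)
      = ((f t * Real.cos (n * (2 * Real.pi / T) * t) : ℝ) : ℂ)
        - ((f t * Real.sin (n * (2 * Real.pi / T) * t) : ℝ) : ℂ) * Complex.I := by
    intro t
    rw [fourier_coe_apply]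
    have : 2 * (Real.pi : ℂ) * Complex.I * ((-n : ℤ) : ℂ) * (t : ℂ) / ((T - 0 : ℝ) : ℂ)
        = ((-(n * (2 * Real.pi / T) * t) : ℝ) : ℂ) * Complex.I := by
      push_cast
      simp only [sub_zero]
      field_simp
    rw [this, Complex.exp_mul_I, ← Complex.ofReal_cos, ← Complex.ofReal_sin, Real.cos_neg,
      Real.sin_neg]
    push_cast
    simp only [smul_eq_mul]
    ring
  simp_rw [h]
  rw [integral_sub, integral_mul_const, integral_complex_ofReal, integral_complex_ofReal]
  · simp only [sub_zero, Complex.real_smul]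
    push_cast
    ring
  · exact (integrable_mul_cos hf _).ofReal
  · exact (integrable_mul_sin hf _).ofReal.mul_const _

/-- Parseval's identity for the real trigonometric system on `(0,T)`. -/
lemma hasSum_sq_trig {T : ℝ} (hT : 0 < T) {f : ℝ → ℝ} (hf : MemLp f 2 (muT T)) :
    HasSum (fun k : ℕ => cosC T f k ^ 2 + sinC T f k ^ 2)
      (2 / T * ∫ t, f t ^ 2 ∂(muT T) + cosC T f 0 ^ 2 / 2) := by
  have hfi : Integrable f (muT T) := hf.integrable (by norm_num)
  have hf' : MemLp (fun t => (f t : ℂ)) 2 (volume.restrict (Ioc 0 T)) := by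
    rw [← restrict_Ioo_eq_restrict_Ioc]
    exact hf.ofReal
  -- Frequencies `k` and `-k` are paired over `k : ℕ`, so frequency zero is counted twice; this
  -- produces the extra `cosC T f 0 ^ 2 / 2`.
  have h := (hasSum_sq_fourierCoeffOn hT hf').nat_add_neg.mul_left 2
  have hn : ∀ n : ℤ, ‖fourierCoeffOn hT (fun t => (f t : ℂ)) n‖ ^ 2
      = (1 / T * ∫ t, f t * Real.cos (n * (2 * Real.pi / T) * t) ∂(muT T)) ^ 2
        + (1 / T * ∫ t, f t * Real.sin (n * (2 * Real.pi / T) * t) ∂(muT T)) ^ 2 := by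
    intro n
    rw [fourierCoeffOn_ofReal hT hfi, ← Complex.normSq_eq_norm_sq, Complex.normSq_apply]
    simp
    ring
  convert! h using 1
  · funext k
    rw [hn, hn]
    simp only [cosC, sinC, intervalIntegral_eq_muT hT]
    push_cast
    simp only [neg_mul, Real.cos_neg, Real.sin_neg, mul_neg, integral_neg]
    ring
  · rw [hn, intervalIntegral.integral_of_le hT.le, integral_Ioc_eq_integral_Ioo]
    simp only [cosC, intervalIntegral_eq_muT hT]
    simp
    ring

/-- The partial sum over `{0}` shows that the zero-mode excess in Parseval is at most `2 / T * ∫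
f²`, which doubles the constant to `4 / T`. -/
lemma sum_sq_trig_le {T : ℝ} (hT : 0 < T) {f : ℝ → ℝ} (hf : MemLp f 2 (muT T)) (s : Finset ℕ) :
    ∑ k ∈ s, (cosC T f k ^ 2 + sinC T f k ^ 2) ≤ 4 / T * ∫ t, f t ^ 2 ∂(muT T) := by
  have h := hasSum_sq_trig hT hf
  have hs := fun s => sum_le_hasSum s (fun k _ => by positivity) h
  have h0 := hs {0}
  have hss := hs s
  simp only [Finset.sum_singleton] at h0
  have : (4 : ℝ) / T = 2 * (2 / T) := by ring
  rw [this]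
  nlinarith [sq_nonneg (sinC T f 0)]

/-- Parseval's identity, bilinear form. -/
lemma hasSum_mul_trig {T : ℝ} (hT : 0 < T) {f g : ℝ → ℝ} (hf : MemLp f 2 (muT T))
    (hg : MemLp g 2 (muT T)) :
    HasSum (fun k : ℕ => cosC T f k * cosC T g k + sinC T f k * sinC T g k)
      (2 / T * ∫ t, f t * g t ∂(muT T) + cosC T f 0 * cosC T g 0 / 2) := by
  have hfi : Integrable f (muT T) := hf.integrable (by norm_num)
  have hgi : Integrable g (muT T) := hg.integrable (by norm_num)
  -- Polarization of the quadratic identity.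
  have h := (((hasSum_sq_trig hT (hf.add hg)).sub (hasSum_sq_trig hT hf)).sub
    (hasSum_sq_trig hT hg)).mul_left (1 / 2)
  have hc := cosC_add hT hfi hgi
  have hs := sinC_add hT hfi hgi
  have e : (f + g) = fun t => f t + g t := rfl
  simp only [e, hc, hs] at h
  have hi : ∫ t, (f t + g t) ^ 2 ∂(muT T)
      = ∫ t, f t ^ 2 ∂(muT T) + 2 * ∫ t, f t * g t ∂(muT T) + ∫ t, g t ^ 2 ∂(muT T) := by
    have hfg : Integrable (fun t => f t * g t) (muT T) := hf.integrable_mul hg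
    have e2 : ∀ t, (f t + g t) ^ 2 = f t ^ 2 + 2 * (f t * g t) + g t ^ 2 := fun t => by ring
    simp_rw [e2]
    rw [integral_add _ hg.integrable_sq, integral_add hf.integrable_sq (hfg.const_mul 2),
      integral_const_mul]
    exact hf.integrable_sq.add (hfg.const_mul 2)
  convert! h using 1
  · funext k; ring
  · rw [hi]; ring

/-! ### Fourier analysis in time on the cylinder. -/

lemma muQ_eq_prod {d : ℕ} (Ω : Set (Sp d)) (T : ℝ) : muQ Ω T = (muO Ω).prod (muT T) := by
  rw [Measure.prod_restrict, ← Measure.volume_eq_prod]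
  rfl

lemma isFiniteMeasure_muO {d : ℕ} {Ω : Set (Sp d)} (hΩb : Bornology.IsBounded Ω) :
    IsFiniteMeasure (muO Ω) :=
  isFiniteMeasure_restrict.2 hΩb.measure_lt_top.ne

lemma isFiniteMeasure_muQ {d : ℕ} {Ω : Set (Sp d)} (hΩb : Bornology.IsBounded Ω) (T : ℝ) :
    IsFiniteMeasure (muQ Ω T) := by
  have := isFiniteMeasure_muO hΩb
  rw [muQ_eq_prod]
  infer_instance

lemma ae_memLp_slice {d : ℕ} {Ω : Set (Sp d)} {T : ℝ} {u : Sp d × ℝ → ℝ}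
    (hu : MemLp u 2 (muQ Ω T)) : ∀ᵐ x ∂(muO Ω), MemLp (fun t => u (x, t)) 2 (muT T) := by
  rw [muQ_eq_prod] at hu
  filter_upwards [hu.integrable_sq.prod_right_ae, hu.1.prodMk_left] with x h1 h2
  exact (memLp_two_iff_integrable_sq h2).2 h1

lemma aestronglyMeasurable_cosCoeff {d : ℕ} {Ω : Set (Sp d)} {T : ℝ} (hT : 0 < T)
    {u : Sp d × ℝ → ℝ} (hu : AEStronglyMeasurable u (muQ Ω T)) (k : ℕ) :
    AEStronglyMeasurable (cosCoeff T u k) (muO Ω) := by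
  rw [muQ_eq_prod] at hu
  have hm : AEStronglyMeasurable (fun z : Sp d × ℝ => Real.cos (k * (2 * Real.pi / T) * z.2))
      ((muO Ω).prod (muT T)) := Continuous.aestronglyMeasurable (by fun_prop)
  have h := (hu.mul hm).integral_prod_right'.const_mul (2 / T)
  refine h.congr (ae_of_all _ fun x => ?_)
  simp only [cosCoeff, intervalIntegral_eq_muT hT, Pi.mul_apply]

lemma aestronglyMeasurable_sinCoeff {d : ℕ} {Ω : Set (Sp d)} {T : ℝ} (hT : 0 < T)
    {u : Sp d × ℝ → ℝ} (hu : AEStronglyMeasurable u (muQ Ω T)) (k : ℕ) :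
    AEStronglyMeasurable (sinCoeff T u k) (muO Ω) := by
  rw [muQ_eq_prod] at hu
  have hm : AEStronglyMeasurable (fun z : Sp d × ℝ => Real.sin (k * (2 * Real.pi / T) * z.2))
      ((muO Ω).prod (muT T)) := Continuous.aestronglyMeasurable (by fun_prop)
  have h := (hu.mul hm).integral_prod_right'.const_mul (2 / T)
  refine h.congr (ae_of_all _ fun x => ?_)
  simp only [sinCoeff, intervalIntegral_eq_muT hT, Pi.mul_apply]

/-- Bessel's inequality in time at almost every point of `Ω`. -/
lemma ae_sum_coeff_sq_le {d : ℕ} {Ω : Set (Sp d)} {T : ℝ} (hT : 0 < T) {u : Sp d × ℝ → ℝ}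
    (hu : MemLp u 2 (muQ Ω T)) : ∀ᵐ x ∂(muO Ω), ∀ s : Finset ℕ,
      ∑ k ∈ s, (cosCoeff T u k x ^ 2 + sinCoeff T u k x ^ 2)
        ≤ 4 / T * ∫ t, u (x, t) ^ 2 ∂(muT T) := by
  filter_upwards [ae_memLp_slice hu] with x hx s
  exact sum_sq_trig_le hT hx s

lemma integrable_integral_sq {d : ℕ} {Ω : Set (Sp d)} {T : ℝ} {u : Sp d × ℝ → ℝ}
    (hu : MemLp u 2 (muQ Ω T)) : Integrable (fun x => ∫ t, u (x, t) ^ 2 ∂(muT T)) (muO Ω) := by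
  rw [muQ_eq_prod] at hu
  exact hu.integrable_sq.integral_prod_left

lemma integrable_coeff_sq {d : ℕ} {Ω : Set (Sp d)} {T : ℝ} (hT : 0 < T) {u : Sp d × ℝ → ℝ}
    (hu : MemLp u 2 (muQ Ω T)) (k : ℕ) :
    Integrable (fun x => cosCoeff T u k x ^ 2 + sinCoeff T u k x ^ 2) (muO Ω) := by
  refine Integrable.mono' ((integrable_integral_sq hu).const_mul (4 / T))
    (((aestronglyMeasurable_cosCoeff hT hu.1 k).pow 2).add
      ((aestronglyMeasurable_sinCoeff hT hu.1 k).pow 2)) ?_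
  filter_upwards [ae_sum_coeff_sq_le hT hu] with x hx
  rw [Real.norm_of_nonneg (by positivity)]
  simpa using hx {k}

/-- Bessel's inequality in time, integrated over `Ω`. -/
lemma summable_integral_coeff_sq {d : ℕ} {Ω : Set (Sp d)} {T : ℝ} (hT : 0 < T)
    {u : Sp d × ℝ → ℝ} (hu : MemLp u 2 (muQ Ω T)) :
    Summable fun k : ℕ => ∫ x, (cosCoeff T u k x ^ 2 + sinCoeff T u k x ^ 2) ∂(muO Ω) := by
  refine summable_of_sum_le (c := ∫ x, 4 / T * ∫ t, u (x, t) ^ 2 ∂(muT T) ∂(muO Ω))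
    (fun k => integral_nonneg fun x => by positivity) fun s => ?_
  rw [← integral_finsetSum _ fun k _ => integrable_coeff_sq hT hu k]
  exact integral_mono_ae (integrable_finsetSum _ fun k _ => integrable_coeff_sq hT hu k)
    ((integrable_integral_sq hu).const_mul _)
    ((ae_sum_coeff_sq_le hT hu).mono fun x hx => hx s)

lemma ae_coeff_add {d : ℕ} {Ω : Set (Sp d)} {T : ℝ} (hT : 0 < T) {u v : Sp d × ℝ → ℝ}
    (hu : MemLp u 2 (muQ Ω T)) (hv : MemLp v 2 (muQ Ω T)) : ∀ᵐ x ∂(muO Ω), ∀ k : ℕ,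
      cosCoeff T (fun z => u z + v z) k x = cosCoeff T u k x + cosCoeff T v k x ∧
      sinCoeff T (fun z => u z + v z) k x = sinCoeff T u k x + sinCoeff T v k x := by
  filter_upwards [ae_memLp_slice hu, ae_memLp_slice hv] with x h1 h2 k
  exact ⟨cosC_add hT (h1.integrable (by norm_num)) (h2.integrable (by norm_num)) k,
    sinC_add hT (h1.integrable (by norm_num)) (h2.integrable (by norm_num)) k⟩

/-- Parseval's identity in time, with a bounded weight on `Ω`. -/
lemma hasSum_integral_weight_mul_coeff {d : ℕ} {Ω : Set (Sp d)} (hΩ : IsOpen Ω) {T : ℝ}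
    (hT : 0 < T) {σ : Sp d → ℝ} (hσm : AEMeasurable σ (muO Ω)) {M : ℝ}
    (hσ : ∀ x ∈ Ω, |σ x| ≤ M) {u v : Sp d × ℝ → ℝ}
    (hu : MemLp u 2 (muQ Ω T)) (hv : MemLp v 2 (muQ Ω T))
    (hu0 : cosCoeff T u 0 =ᵐ[muO Ω] 0) :
    HasSum (fun k : ℕ => ∫ x, σ x * (cosCoeff T u k x * cosCoeff T v k x
        + sinCoeff T u k x * sinCoeff T v k x) ∂(muO Ω))
      (2 / T * ∫ z, σ z.1 * u z * v z ∂(muQ Ω T)) := by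
  have hσae : ∀ᵐ x ∂(muO Ω), |σ x| ≤ M :=
    (ae_restrict_mem hΩ.measurableSet).mono hσ
  have hm : ∀ k, AEStronglyMeasurable (fun x => σ x * (cosCoeff T u k x * cosCoeff T v k x
        + sinCoeff T u k x * sinCoeff T v k x)) (muO Ω) := fun k =>
    hσm.aestronglyMeasurable.mul
      (((aestronglyMeasurable_cosCoeff hT hu.1 k).mul (aestronglyMeasurable_cosCoeff hT hv.1 k)).add
      ((aestronglyMeasurable_sinCoeff hT hu.1 k).mul (aestronglyMeasurable_sinCoeff hT hv.1 k)))
  have hbi : ∀ k, Integrable (fun x => M * ((cosCoeff T u k x ^ 2 + sinCoeff T u k x ^ 2)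
      + (cosCoeff T v k x ^ 2 + sinCoeff T v k x ^ 2))) (muO Ω) := fun k =>
    ((integrable_coeff_sq hT hu k).add (integrable_coeff_sq hT hv k)).const_mul M
  have hb : ∀ k, ∀ᵐ x ∂(muO Ω), ‖σ x * (cosCoeff T u k x * cosCoeff T v k x
        + sinCoeff T u k x * sinCoeff T v k x)‖ ≤ M * ((cosCoeff T u k x ^ 2 + sinCoeff T u k x ^ 2)
      + (cosCoeff T v k x ^ 2 + sinCoeff T v k x ^ 2)) := by
    intro k
    filter_upwards [hσae] with x hx
    rw [norm_mul]
    refine mul_le_mul hx ?_ (norm_nonneg _) ((abs_nonneg _).trans hx)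
    rw [Real.norm_eq_abs, abs_le]
    constructor <;> nlinarith [sq_nonneg (cosCoeff T u k x + cosCoeff T v k x),
      sq_nonneg (cosCoeff T u k x - cosCoeff T v k x),
      sq_nonneg (sinCoeff T u k x + sinCoeff T v k x),
      sq_nonneg (sinCoeff T u k x - sinCoeff T v k x)]
  have hFi := fun k => (hbi k).mono' (hm k) (hb k)
  -- Bessel's inequality for `u` and `v` gives absolute summability, which permits exchanging the
  -- sum with the integral over `Ω`.
  have hsum : Summable fun k : ℕ => ∫ x, ‖σ x * (cosCoeff T u k x * cosCoeff T v k x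
        + sinCoeff T u k x * sinCoeff T v k x)‖ ∂(muO Ω) := by
    refine Summable.of_nonneg_of_le (fun k => integral_nonneg fun x => norm_nonneg _)
      (fun k => integral_mono_ae (hFi k).norm (hbi k) (hb k)) ?_
    have := ((summable_integral_coeff_sq hT hu).add (summable_integral_coeff_sq hT hv)).mul_left M
    refine this.congr fun k => ?_
    rw [integral_const_mul, integral_add (integrable_coeff_sq hT hu k)
      (integrable_coeff_sq hT hv k)]
  have h := hasSum_integral_of_summable_integral_norm hFi hsum
  convert! h using 1
  have hi : Integrable (fun z => σ z.1 * u z * v z) (muQ Ω T) := by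
    have h1 : Integrable (fun z => u z * v z) (muQ Ω T) := hu.integrable_mul hv
    have h2 : Integrable (fun z => σ z.1 * (u z * v z)) (muQ Ω T) := by
      rw [muQ_eq_prod] at h1 ⊢
      refine h1.bdd_mul (c := M) hσm.aestronglyMeasurable.comp_fst ?_
      exact Measure.quasiMeasurePreserving_fst.ae hσae
    simpa only [mul_assoc] using h2
  rw [muQ_eq_prod] at hi ⊢
  rw [integral_prod _ hi, ← integral_const_mul]
  refine integral_congr_ae ?_
  filter_upwards [ae_memLp_slice hu, ae_memLp_slice hv, hu0] with x h1 h2 h0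
  have hp := (hasSum_mul_trig hT h1 h2).mul_left (σ x)
  -- A vanishing time mean of `u` removes the zero-mode correction.
  have h0' : cosC T (fun t => u (x, t)) 0 = 0 := h0
  have := hp.tsum_eq
  rw [h0'] at this
  refine Eq.trans ?_ this.symm
  simp only [mul_assoc, integral_const_mul]
  ring

/-! ### Periodic integration by parts in time. -/

lemma isTest_mul {d : ℕ} {Ω : Set (Sp d)} {ψ : Sp d → ℝ} (hψ : IsTest Ω ψ) {g : ℝ → ℝ}
    (hg : ContDiff ℝ ∞ g) (hgc : HasCompactSupport g) :
    IsTest (Ω ×ˢ univ) (fun z : Sp d × ℝ => ψ z.1 * g z.2) := by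
  obtain ⟨h1, h2, h3⟩ := hψ
  have hsub : tsupport (fun z : Sp d × ℝ => ψ z.1 * g z.2) ⊆ tsupport ψ ×ˢ tsupport g := by
    refine closure_minimal ?_ ((isClosed_tsupport _).prod (isClosed_tsupport _))
    intro z hz
    exact ⟨subset_tsupport _ (left_ne_zero_of_mul hz), subset_tsupport _ (right_ne_zero_of_mul hz)⟩
  exact ⟨(h1.comp contDiff_fst).mul (hg.comp contDiff_snd),
    (h2.isCompact.prod hgc.isCompact).of_isClosed_subset (isClosed_tsupport _) hsub,
    hsub.trans (prod_mono h3 (subset_univ _))⟩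

lemma integrable_mul_of_continuous {d : ℕ} {Ω : Set (Sp d)} {T : ℝ} (hΩb : Bornology.IsBounded Ω)
    {u : Sp d × ℝ → ℝ} (hu : MemLp u 2 (muQ Ω T)) {g : ℝ → ℝ} (hg : Continuous g) :
    Integrable (fun z => u z * g z.2) (muQ Ω T) := by
  have := isFiniteMeasure_muQ hΩb T
  obtain ⟨C, hC⟩ := (isCompact_Icc (a := (0 : ℝ)) (b := T)).exists_bound_of_continuousOn
    hg.continuousOn
  refine (hu.integrable (by norm_num)).mul_bdd (c := C)
    (Continuous.aestronglyMeasurable (by fun_prop)) ?_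
  rw [muQ_eq_prod]
  exact Measure.quasiMeasurePreserving_snd.ae ((ae_restrict_mem measurableSet_Ioo).mono
    fun t ht => hC t (Ioo_subset_Icc_self ht))

/-- Integration by parts in time, at almost every point of `Ω`, for a time-periodic function. -/
lemma ae_integral_deriv_add_eq_zero {d : ℕ} {Ω : Set (Sp d)} (hΩ : IsOpen Ω)
    (hΩb : Bornology.IsBounded Ω) {T : ℝ} (hT : 0 < T) {u D : Sp d × ℝ → ℝ}
    (hu : MemH01Per Ω T u D) {g : ℝ → ℝ} (hg : ContDiff ℝ ∞ g) (hgT : g 0 = g T) :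
    ∀ᵐ x ∂(muO Ω), ∫ t, (u (x, t) * deriv g t + D (x, t) * g t) ∂(muT T) = 0 := by
  have hfin := isFiniteMeasure_muO hΩb
  obtain ⟨a, b, ⟨-, -, htr⟩, hab⟩ := hu.periodic
  have hgd : Continuous (deriv g) := hg.continuous_deriv (by simp)
  have hui := integrable_mul_of_continuous hΩb hu.memLp hgd
  have hDi := integrable_mul_of_continuous hΩb hu.deriv_memLp hg.continuous
  have hwi := hui.add hDi
  rw [muQ_eq_prod] at hwi
  have hF : Integrable (fun x => ∫ t, (u (x, t) * deriv g t + D (x, t) * g t) ∂(muT T))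
    (muO Ω) := hwi.integral_prod_left
  -- Fundamental lemma of the calculus of variations in `x`: it suffices to test the time integral
  -- against every `ψ ∈ C_c^∞(Ω)`.
  have key := hΩ.ae_eq_zero_of_integral_contDiff_smul_eq_zero
    (μ := volume) (f := fun x => ∫ t, (u (x, t) * deriv g t + D (x, t) * g t) ∂(muT T))
    (IntegrableOn.locallyIntegrableOn hF) ?_
  · exact (ae_restrict_iff' hΩ.measurableSet).2 key
  intro ψ h1 h2 h3
  have hψ : IsTest Ω ψ := ⟨h1, h2, h3⟩
  -- The trace identity needs compact support in time, which `g` may lack; the cutoff equals one on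
  -- `[-T/2, 3T/2]`, a neighbourhood of `[0,T]`, so it is invisible on `Q` and at both ends.
  let χ : ContDiffBump (T / 2) := ⟨T, 2 * T, hT, by linarith⟩
  have hχ1 : ∀ t ∈ Ioo (-(T / 2)) (3 * T / 2), χ t = 1 := fun t ht =>
    χ.one_of_mem_closedBall (by
      rw [Real.closedBall_eq_Icc]
      exact ⟨by change T / 2 - T ≤ t; linarith [ht.1], by change t ≤ T / 2 + T; linarith [ht.2]⟩)
  have hφ := isTest_mul hψ (χ.contDiff.mul hg) (χ.hasCompactSupport.mul_right (f' := g))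
  have h := htr _ hφ
  -- The boundary terms cancel: both `u` and `g` agree at the two ends.
  have hends : ∫ x, b x * (ψ x * (χ T * g T)) ∂(muO Ω) = ∫ x, a x * (ψ x * (χ 0 * g 0)) ∂(muO Ω) := by
    refine integral_congr_ae ?_
    filter_upwards [hab] with x hx
    simp only [hx, hχ1 T ⟨by linarith, by linarith⟩,
      hχ1 0 ⟨by linarith, by linarith⟩, hgT]
  rw [hends, sub_self] at h
  have hae : ∀ᵐ z ∂(muQ Ω T), z ∈ cyl Ω T :=
    ae_restrict_mem (hΩ.measurableSet.prod measurableSet_Ioo)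
  have e1 : ∫ z, u z * dT (fun z : Sp d × ℝ => ψ z.1 * (χ z.2 * g z.2)) z ∂(muQ Ω T)
      = ∫ z, ψ z.1 * (u z * deriv g z.2) ∂(muQ Ω T) := by
    refine integral_congr_ae ?_
    filter_upwards [hae] with z hz
    have he : (fun s => ψ z.1 * (χ s * g s)) =ᶠ[𝓝 z.2] fun s => ψ z.1 * g s := by
      filter_upwards [isOpen_Ioo.mem_nhds hz.2] with s hs
      simp [hχ1 s ⟨by linarith [hs.1], by linarith [hs.2]⟩]
    simp only [dT]
    rw [he.deriv_eq, deriv_const_mul_field]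
    ring
  have e2 : ∫ z, D z * (ψ z.1 * (χ z.2 * g z.2)) ∂(muQ Ω T)
      = ∫ z, ψ z.1 * (D z * g z.2) ∂(muQ Ω T) := by
    refine integral_congr_ae ?_
    filter_upwards [hae] with z hz
    simp only [hχ1 z.2 ⟨by linarith [hz.2.1], by linarith [hz.2.2]⟩]
    ring
  rw [e1, e2] at h
  obtain ⟨C, hC⟩ := h1.continuous.bounded_above_of_compact_support h2
  have hψm : AEStronglyMeasurable (fun z : Sp d × ℝ => ψ z.1) (muQ Ω T) :=
    (h1.continuous.comp continuous_fst).aestronglyMeasurable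
  have i1 := hui.bdd_mul (c := C) hψm (ae_of_all _ fun z => hC z.1)
  have i2 := hDi.bdd_mul (c := C) hψm (ae_of_all _ fun z => hC z.1)
  rw [← integral_add i1 i2] at h
  have i3 : Integrable (fun z : Sp d × ℝ => ψ z.1 * (u z * deriv g z.2) + ψ z.1 * (D z * g z.2))
      (muQ Ω T) := i1.add i2
  rw [muQ_eq_prod] at h i3
  rw [integral_prod _ i3] at h
  rw [← setIntegral_eq_integral_of_forall_compl_eq_zero (s := Ω)]
  · rw [← h]
    refine integral_congr_ae (ae_of_all _ fun x => ?_)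
    simp only [smul_eq_mul, ← mul_add, integral_const_mul]
  · intro x hx
    rw [image_eq_zero_of_notMem_tsupport (fun h => hx (h3 h)), zero_smul]

/-- Fourier coefficients of the time derivative of a time-periodic function. -/
lemma ae_coeff_deriv {d : ℕ} {Ω : Set (Sp d)} (hΩ : IsOpen Ω)
    (hΩb : Bornology.IsBounded Ω) {T : ℝ} (hT : 0 < T) {u D : Sp d × ℝ → ℝ}
    (hu : MemH01Per Ω T u D) : ∀ᵐ x ∂(muO Ω), ∀ k : ℕ,
      cosCoeff T D k x = k * (2 * Real.pi / T) * sinCoeff T u k x ∧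
      sinCoeff T D k x = -(k * (2 * Real.pi / T) * cosCoeff T u k x) := by
  rw [ae_all_iff]
  intro k
  have hTk : (k : ℝ) * (2 * Real.pi / T) * T = k * (2 * Real.pi) := by field_simp
  have hdc : ∀ t, deriv (fun t => Real.cos (k * (2 * Real.pi / T) * t)) t
      = -(k * (2 * Real.pi / T) * Real.sin (k * (2 * Real.pi / T) * t)) := fun t => by
    have := ((hasDerivAt_id t).const_mul ((k : ℝ) * (2 * Real.pi / T))).cos.deriv
    simp only [id, mul_one] at this
    rw [this]; ring
  have hds : ∀ t, deriv (fun t => Real.sin (k * (2 * Real.pi / T) * t)) t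
      = k * (2 * Real.pi / T) * Real.cos (k * (2 * Real.pi / T) * t) := fun t => by
    have := ((hasDerivAt_id t).const_mul ((k : ℝ) * (2 * Real.pi / T))).sin.deriv
    simp only [id, mul_one] at this
    rw [this]; ring
  have hc := ae_integral_deriv_add_eq_zero hΩ hΩb hT hu
    (g := fun t => Real.cos (k * (2 * Real.pi / T) * t)) (by fun_prop)
    (by simp only [hTk, mul_zero, Real.cos_zero, Real.cos_nat_mul_two_pi])
  have hs := ae_integral_deriv_add_eq_zero hΩ hΩb hT hu
    (g := fun t => Real.sin (k * (2 * Real.pi / T) * t)) (by fun_prop)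
    (by
      have := Real.sin_nat_mul_pi (2 * k)
      push_cast at this
      simp only [hTk, mul_zero, Real.sin_zero]
      rw [← this]; congr 1; ring)
  filter_upwards [hc, hs, ae_memLp_slice hu.memLp, ae_memLp_slice hu.deriv_memLp]
    with x h1 h2 hux hDx
  have hui : Integrable (fun t => u (x, t)) (muT T) := hux.integrable (by norm_num)
  have hDi : Integrable (fun t => D (x, t)) (muT T) := hDx.integrable (by norm_num)
  have c1 := integrable_mul_cos hui (k * (2 * Real.pi / T))
  have s1 := integrable_mul_sin hui (k * (2 * Real.pi / T))
  have c2 := integrable_mul_cos hDi (k * (2 * Real.pi / T))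
  have s2 := integrable_mul_sin hDi (k * (2 * Real.pi / T))
  have r1 : ∀ t, u (x, t) * -(k * (2 * Real.pi / T) * Real.sin (k * (2 * Real.pi / T) * t))
      = -(k * (2 * Real.pi / T)) * (u (x, t) * Real.sin (k * (2 * Real.pi / T) * t)) :=
    fun t => by ring
  have r2 : ∀ t, u (x, t) * (k * (2 * Real.pi / T) * Real.cos (k * (2 * Real.pi / T) * t))
      = (k * (2 * Real.pi / T)) * (u (x, t) * Real.cos (k * (2 * Real.pi / T) * t)) :=
    fun t => by ring
  simp only [hdc, hds, r1, r2] at h1 h2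
  rw [integral_add (s1.const_mul _) c2, integral_const_mul] at h1
  rw [integral_add (c1.const_mul _) s2, integral_const_mul] at h2
  simp only [cosCoeff, sinCoeff, intervalIntegral_eq_muT hT]
  constructor
  · linear_combination (2 / T) * h1
  · linear_combination (2 / T) * h2

/-! ### The half-derivative form. -/

/-- A function in `H^{0,1}_per(Q)` has half a time derivative. -/
lemma MemH01Per.half_finite {d : ℕ} {Ω : Set (Sp d)} (hΩ : IsOpen Ω)
    (hΩb : Bornology.IsBounded Ω) {T : ℝ} (hT : 0 < T) {u D : Sp d × ℝ → ℝ}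
    (hu : MemH01Per Ω T u D) :
    Summable fun k : ℕ => (k : ℝ) * (2 * Real.pi / T) *
      ∫ x, (cosCoeff T u k x ^ 2 + sinCoeff T u k x ^ 2) ∂(muO Ω) := by
  have hω : 0 < 2 * Real.pi / T := by positivity
  refine Summable.of_nonneg_of_le (fun k => mul_nonneg (by positivity)
    (integral_nonneg fun x => by positivity)) (fun k => ?_)
    ((summable_integral_coeff_sq hT hu.deriv_memLp).mul_left (1 / (2 * Real.pi / T)))
  have e : ∫ x, (cosCoeff T D k x ^ 2 + sinCoeff T D k x ^ 2) ∂(muO Ω)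
      = (k * (2 * Real.pi / T)) ^ 2 *
        ∫ x, (cosCoeff T u k x ^ 2 + sinCoeff T u k x ^ 2) ∂(muO Ω) := by
    rw [← integral_const_mul]
    refine integral_congr_ae ?_
    filter_upwards [ae_coeff_deriv hΩ hΩb hT hu] with x hx
    rw [(hx k).1, (hx k).2]
    ring
  rw [e, ← mul_assoc]
  refine mul_le_mul_of_nonneg_right ?_ (integral_nonneg fun x => by positivity)
  -- For integers this gives `kω ≤ (kω)² / ω`, so the series for `D` dominates.
  have hk : (k : ℝ) ≤ k ^ 2 := by
    exact_mod_cast Nat.le_self_pow two_ne_zero k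
  calc (k : ℝ) * (2 * Real.pi / T) ≤ k ^ 2 * (2 * Real.pi / T) := by gcongr
    _ = _ := by field_simp

/-- The difference of two functions with half a time derivative has half a time derivative. -/
lemma half_finite_sub {d : ℕ} {Ω : Set (Sp d)} {T : ℝ} (hT : 0 < T) {u v : Sp d × ℝ → ℝ}
    (hu : MemLp u 2 (muQ Ω T)) (hv : MemLp v 2 (muQ Ω T))
    (hu2 : Summable fun k : ℕ => (k : ℝ) * (2 * Real.pi / T) *
      ∫ x, (cosCoeff T u k x ^ 2 + sinCoeff T u k x ^ 2) ∂(muO Ω))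
    (hv2 : Summable fun k : ℕ => (k : ℝ) * (2 * Real.pi / T) *
      ∫ x, (cosCoeff T v k x ^ 2 + sinCoeff T v k x ^ 2) ∂(muO Ω)) :
    Summable fun k : ℕ => (k : ℝ) * (2 * Real.pi / T) *
      ∫ x, (cosCoeff T (fun z => u z - v z) k x ^ 2
        + sinCoeff T (fun z => u z - v z) k x ^ 2) ∂(muO Ω) := by
  refine Summable.of_nonneg_of_le (fun k => mul_nonneg (by positivity)
    (integral_nonneg fun x => add_nonneg (sq_nonneg _) (sq_nonneg _))) (fun k => ?_)
    ((hu2.add hv2).mul_left 2)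
  have iu := integrable_coeff_sq hT hu k
  have iv := integrable_coeff_sq hT hv k
  rw [← mul_add, ← integral_add iu iv, mul_left_comm, ← integral_const_mul (2 : ℝ)]
  have hk : 0 ≤ (k : ℝ) * (2 * Real.pi / T) := by positivity
  refine mul_le_mul_of_nonneg_left ?_ hk
  refine integral_mono_ae (integrable_coeff_sq hT (hu.sub hv) k) ((iu.add iv).const_mul 2) ?_
  -- Writing `u = (u - v) + v` needs only additivity of the coefficients. With `w` a coefficient of
  -- `u - v`, the final inequality is `2(w + v)² + 2v² - w² = (w + 2v)² ≥ 0`.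
  filter_upwards [ae_coeff_add hT (hu.sub hv) hv] with x hx
  have h1 := (hx k).1
  have h2 := (hx k).2
  simp only [Pi.sub_apply, sub_add_cancel] at h1 h2
  have e : (u - v) = fun z => u z - v z := rfl
  rw [e] at h1 h2
  have h1' : cosCoeff T u k x = cosCoeff T (fun z => u z - v z) k x + cosCoeff T v k x := h1
  have h2' : sinCoeff T u k x = sinCoeff T (fun z => u z - v z) k x + sinCoeff T v k x := h2
  rw [h1', h2']
  nlinarith [sq_nonneg (cosCoeff T (fun z => u z - v z) k x + 2 * cosCoeff T v k x),
    sq_nonneg (sinCoeff T (fun z => u z - v z) k x + 2 * sinCoeff T v k x)]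

/-- For `ζ ∈ H^{0,1}_per(Q)` the form at `(p, p - ζ)` is the integral against `σ ∂_t ζ`. -/
lemma halfPerp_sub_eq_integral {d : ℕ} {Ω : Set (Sp d)} (hΩ : IsOpen Ω)
    (hΩb : Bornology.IsBounded Ω) {T : ℝ} (hT : 0 < T)
    {σ : Sp d → ℝ} (hσm : AEMeasurable σ (muO Ω)) {M : ℝ} (hσ : ∀ x ∈ Ω, |σ x| ≤ M)
    {p ζ D : Sp d × ℝ → ℝ} (hp : MemLp p 2 (muQ Ω T)) (hζ : MemH01Per Ω T ζ D) :
    halfPerp Ω T σ p (fun z => p z - ζ z)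
      = ∫ z, σ z.1 * D z * (p z - ζ z) ∂(muQ Ω T) := by
  have he : MemLp (fun z => p z - ζ z) 2 (muQ Ω T) := hp.sub hζ.memLp
  have hD := ae_coeff_deriv hΩ hΩb hT hζ
  have hD0 : cosCoeff T D 0 =ᵐ[muO Ω] 0 := by
    filter_upwards [hD] with x hx
    simpa using (hx 0).1
  have hs := (hasSum_integral_weight_mul_coeff hΩ hT hσm hσ hζ.deriv_memLp he hD0).tsum_eq
  -- After `p = e + ζ`, the `e`-`e` products cancel pointwise and the rest is a product of
  -- coefficients of `D` and `e`. The rewriting precedes summation, so `p` need only be in `L²`.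
  have hterm : ∀ k : ℕ, (k : ℝ) * (2 * Real.pi / T) *
      ∫ x, σ x * (cosCoeff T p k x * (-sinCoeff T (fun z => p z - ζ z) k x)
        + sinCoeff T p k x * cosCoeff T (fun z => p z - ζ z) k x) ∂(muO Ω)
      = ∫ x, σ x * (cosCoeff T D k x * cosCoeff T (fun z => p z - ζ z) k x
        + sinCoeff T D k x * sinCoeff T (fun z => p z - ζ z) k x) ∂(muO Ω) := by
    intro k
    rw [← integral_const_mul]
    refine integral_congr_ae ?_
    filter_upwards [hD, ae_coeff_add hT he hζ.memLp] with x h1 h2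
    have h3 := (h2 k).1
    have h4 := (h2 k).2
    simp only [sub_add_cancel] at h3 h4
    have h3' : cosCoeff T p k x = _ := h3
    have h4' : sinCoeff T p k x = _ := h4
    rw [(h1 k).1, (h1 k).2, h3', h4']
    ring
  unfold halfPerp
  simp only [hterm]
  rw [hs]
  field_simp

/-! ### Inner products and limits in `L²`. -/

section LTwo

variable {α : Type*} [MeasurableSpace α] {μ : Measure α}
  {E : Type*} [NormedAddCommGroup E] [InnerProductSpace ℝ E]

lemma integral_inner_eq_inner_toLp {f g : α → E} (hf : MemLp f 2 μ) (hg : MemLp g 2 μ) :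
    ∫ x, inner ℝ (f x) (g x) ∂μ = inner ℝ (hf.toLp f) (hg.toLp g) := by
  rw [L2.inner_def]
  refine integral_congr_ae ?_
  filter_upwards [hf.coeFn_toLp, hg.coeFn_toLp] with x h1 h2
  rw [h1, h2]

lemma integrable_inner_of_memLp {f g : α → E} (hf : MemLp f 2 μ) (hg : MemLp g 2 μ) :
    Integrable (fun x => inner ℝ (f x) (g x)) μ := by
  refine (L2.integrable_inner (𝕜 := ℝ) (hf.toLp f) (hg.toLp g)).congr ?_
  filter_upwards [hf.coeFn_toLp, hg.coeFn_toLp] with x h1 h2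
  rw [h1, h2]

/-- The Cauchy–Schwarz inequality in `L^2`. -/
lemma integral_inner_le {f g : α → E} (hf : MemLp f 2 μ) (hg : MemLp g 2 μ) :
    ∫ x, inner ℝ (f x) (g x) ∂μ ≤ (eLpNorm f 2 μ).toReal * (eLpNorm g 2 μ).toReal := by
  rw [integral_inner_eq_inner_toLp hf hg, ← Lp.norm_toLp f hf, ← Lp.norm_toLp g hg]
  exact real_inner_le_norm _ _

lemma integral_norm_sq_eq {f : α → E} (hf : MemLp f 2 μ) :
    ∫ x, ‖f x‖ ^ 2 ∂μ = (eLpNorm f 2 μ).toReal ^ 2 := by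
  rw [← Lp.norm_toLp f hf, ← real_inner_self_eq_norm_sq, ← integral_inner_eq_inner_toLp hf hf]
  simp only [real_inner_self_eq_norm_sq]

lemma tendsto_integral_inner {f : ℕ → α → E} {f' g : α → E} (hf : ∀ n, MemLp (f n) 2 μ)
    (hf' : MemLp f' 2 μ) (hg : MemLp g 2 μ)
    (h : Tendsto (fun n => eLpNorm (fun x => f n x - f' x) 2 μ) atTop (𝓝 0)) :
    Tendsto (fun n => ∫ x, inner ℝ (g x) (f n x) ∂μ) atTop (𝓝 (∫ x, inner ℝ (g x) (f' x) ∂μ)) := by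
  have := (Lp.tendsto_Lp_iff_tendsto_eLpNorm'' f hf f' hf').2 h
  simp only [integral_inner_eq_inner_toLp hg (hf _), integral_inner_eq_inner_toLp hg hf']
  exact tendsto_const_nhds.inner this

/-- Continuity of the norm; it carries Friedrichs' inequality from test functions to their closure.
-/
lemma tendsto_eLpNorm_two {F : Type*} [NormedAddCommGroup F] {f : ℕ → α → F} {f' : α → F}
    (hf : ∀ n, MemLp (f n) 2 μ)
    (hf' : MemLp f' 2 μ)
    (h : Tendsto (fun n => eLpNorm (fun x => f n x - f' x) 2 μ) atTop (𝓝 0)) :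
    Tendsto (fun n => eLpNorm (f n) 2 μ) atTop (𝓝 (eLpNorm f' 2 μ)) := by
  have := (Lp.tendsto_Lp_iff_tendsto_eLpNorm'' f hf f' hf').2 h
  have h := (continuous_enorm.tendsto _).comp this
  simp only [Function.comp_def, Lp.enorm_toLp] at h
  exact h

lemma eLpNorm_two_sq {F : Type*} [NormedAddCommGroup F] (f : α → F) :
    eLpNorm f 2 μ ^ 2 = ∫⁻ x, ‖f x‖ₑ ^ 2 ∂μ := by
  have h := eLpNorm_nnreal_pow_eq_lintegral (μ := μ) (f := f) (p := 2) two_ne_zero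
  simpa using h

end LTwo

lemma real_inner_eq_mul (a b : ℝ) : inner ℝ a b = a * b := by
  rw [real_inner_eq_re_inner]
  simp [mul_comm]

/-! ### Friedrichs' inequality and its constant. -/

lemma IsTest.memLp {X : Type*} [NormedAddCommGroup X] [NormedSpace ℝ X] [MeasurableSpace X]
    [BorelSpace X] {U : Set X} {φ : X → ℝ} (hφ : IsTest U φ) (μ : Measure X)
    [IsFiniteMeasureOnCompacts μ] : MemLp φ 2 μ :=
  hφ.1.continuous.memLp_of_hasCompactSupport hφ.2.1

lemma gradient_eq {d : ℕ} (ψ : Sp d → ℝ) : gradient ψ = fun x =>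
    (InnerProductSpace.toDual ℝ (Sp d)).symm (fderiv ℝ ψ x) := rfl

lemma IsTest.continuous_gradient {d : ℕ} {Ω : Set (Sp d)} {ψ : Sp d → ℝ} (hψ : IsTest Ω ψ) :
    Continuous (gradient ψ) := by
  have := hψ.1.continuous_fderiv (by simp)
  rw [gradient_eq]
  fun_prop

lemma IsTest.hasCompactSupport_gradient {d : ℕ} {Ω : Set (Sp d)} {ψ : Sp d → ℝ}
    (hψ : IsTest Ω ψ) : HasCompactSupport (gradient ψ) :=
  (hψ.2.1.fderiv ℝ).comp_left (g := (InnerProductSpace.toDual ℝ (Sp d)).symm) (map_zero _)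

lemma IsTest.memLp_gradient {d : ℕ} {Ω : Set (Sp d)} {ψ : Sp d → ℝ} (hψ : IsTest Ω ψ)
    (μ : Measure (Sp d)) [IsFiniteMeasureOnCompacts μ] : MemLp (gradient ψ) 2 μ :=
  hψ.continuous_gradient.memLp_of_hasCompactSupport hψ.hasCompactSupport_gradient

lemma gradient_eq_zero_of_notMem_tsupport {d : ℕ} {ψ : Sp d → ℝ} {x : Sp d}
    (hx : x ∉ tsupport ψ) : gradient ψ x = 0 := by
  rw [gradient_eq]
  simp only [image_eq_zero_of_notMem_tsupport fun h => hx (tsupport_fderiv_subset ℝ h), map_zero]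

/-- Poincaré's inequality for test functions on a bounded set. -/
lemma IsTest.integral_sq_le {d : ℕ} (i : Fin d) {Ω : Set (Sp d)} {R : ℝ}
    (hR : ∀ x ∈ Ω, ‖x‖ ≤ R) {ψ : Sp d → ℝ} (hψ : IsTest Ω ψ) :
    ∫ x, ψ x ^ 2 ≤ (2 * R) ^ 2 * ∫ x, ‖gradient ψ x‖ ^ 2 := by
  have hc := hψ.1.continuous
  have hgc := hψ.continuous_gradient
  have hd : Differentiable ℝ ψ := hψ.1.differentiable (by simp)
  let v : Sp d := EuclideanSpace.single i 1
  have hv : ‖v‖ = 1 := by simp [v]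
  have hf : ∀ x, fderiv ℝ (fun x : Sp d => inner ℝ v x) x v = 1 := fun x => by
    have : HasFDerivAt (fun x : Sp d => inner ℝ v x) (innerSL ℝ v) x := (innerSL ℝ v).hasFDerivAt
    rw [this.fderiv, innerSL_apply_apply, real_inner_self_eq_norm_sq, hv, one_pow]
  have hg : ∀ x, fderiv ℝ (fun x => ψ x ^ 2) x v = 2 * ψ x * inner ℝ v (gradient ψ x) := fun x => by
    rw [((hd x).hasFDerivAt.pow 2).fderiv, inner_gradient_right]
    simp
  have i1 : Integrable fun x => ψ x ^ 2 := (hψ.memLp volume).integrable_sq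
  have i2 : Integrable fun x => ‖gradient ψ x‖ ^ 2 :=
    (memLp_two_iff_integrable_sq_norm hgc.aestronglyMeasurable).1 (hψ.memLp_gradient volume)
  have i3 : Integrable fun x => inner ℝ v x * (2 * ψ x * inner ℝ v (gradient ψ x)) := by
    refine Continuous.integrable_of_hasCompactSupport (by fun_prop) ?_
    refine hψ.2.1.mono fun x hx h0 => hx ?_
    simp only [h0, mul_zero, zero_mul]
  have i4 : Integrable fun x => inner ℝ v x * ψ x ^ 2 := by
    refine Continuous.integrable_of_hasCompactSupport (by fun_prop) ?_
    exact (hψ.2.1.comp_left (g := fun y => y ^ 2) (by simp)).mul_left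
  -- Since `∂_i x_i = 1`, integration by parts gives `∫ ψ² = -∫ x_i · 2ψ ∂_i ψ`.
  have key := integral_mul_fderiv_eq_neg_fderiv_mul_of_integrable (μ := volume) (v := v)
    (f := fun x : Sp d => inner ℝ v x) (g := fun x => ψ x ^ 2)
    (by simpa only [hf, one_mul] using i1) (by simpa only [hg] using i3) i4
    (fun x _ => (innerSL ℝ v).differentiableAt) (fun x _ => by fun_prop)
  simp only [hf, hg, one_mul] at key
  -- Young's inequality with `|x_i| ≤ R` on the support; absorbing `½ ∫ ψ²` on the left leaves the
  -- factor `4R² = (2R)²`.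
  have hpt : ∀ x, -(inner ℝ v x * (2 * ψ x * inner ℝ v (gradient ψ x)))
      ≤ (1 / 2) * ψ x ^ 2 + 2 * R ^ 2 * ‖gradient ψ x‖ ^ 2 := by
    intro x
    by_cases hx : x ∈ tsupport ψ
    · have h1 : |inner ℝ v x| ≤ R := by
        refine (abs_real_inner_le_norm v x).trans ?_
        rw [hv, one_mul]; exact hR x (hψ.2.2 hx)
      have h2 : |inner ℝ v (gradient ψ x)| ≤ ‖gradient ψ x‖ := by
        refine (abs_real_inner_le_norm v _).trans ?_
        rw [hv, one_mul]
      have h3 : (inner ℝ v x * inner ℝ v (gradient ψ x)) ^ 2 ≤ (R * ‖gradient ψ x‖) ^ 2 := by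
        have hR0 : 0 ≤ R := (abs_nonneg _).trans h1
        rw [← sq_abs, abs_mul]
        gcongr
      nlinarith [sq_nonneg (ψ x + 2 * (inner ℝ v x * inner ℝ v (gradient ψ x)))]
    · rw [image_eq_zero_of_notMem_tsupport hx]
      simp only [mul_zero, zero_mul, neg_zero]
      positivity
  have hI := integral_mono i3.neg ((i1.const_mul (1 / 2)).add (i2.const_mul (2 * R ^ 2))) hpt
  simp only [Pi.neg_apply, Pi.add_apply] at hI
  rw [integral_neg, integral_add (i1.const_mul (1 / 2)) (i2.const_mul (2 * R ^ 2)),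
    integral_const_mul, integral_const_mul] at hI
  nlinarith

lemma IsTest.eLpNorm_le {d : ℕ} (i : Fin d) {Ω : Set (Sp d)} {R : ℝ} (hR0 : 0 ≤ R)
    (hR : ∀ x ∈ Ω, ‖x‖ ≤ R) {ψ : Sp d → ℝ} (hψ : IsTest Ω ψ) :
    eLpNorm ψ 2 (muO Ω) ≤ ENNReal.ofReal (2 * R) * eLpNorm (gradient ψ) 2 (muO Ω) := by
  have h := hψ.integral_sq_le i hR
  rw [← setIntegral_eq_integral_of_forall_compl_eq_zero (s := Ω),
    ← setIntegral_eq_integral_of_forall_compl_eq_zero (s := Ω) (f := fun x => ‖gradient ψ x‖ ^ 2)]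
    at h
  · have e := integral_norm_sq_eq (hψ.memLp (muO Ω))
    simp only [Real.norm_eq_abs, sq_abs] at e
    rw [e, integral_norm_sq_eq (hψ.memLp_gradient (muO Ω)), ← mul_pow] at h
    have h' := le_of_sq_le_sq h (by positivity)
    rw [← ENNReal.ofReal_toReal (hψ.memLp (muO Ω)).2.ne,
      ← ENNReal.ofReal_toReal (hψ.memLp_gradient (muO Ω)).2.ne, ← ENNReal.ofReal_mul (by positivity)]
    exact ENNReal.ofReal_le_ofReal h'
  · intro x hx
    rw [gradient_eq_zero_of_notMem_tsupport fun h => hx (hψ.2.2 h)]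
    simp
  · intro x hx
    rw [image_eq_zero_of_notMem_tsupport fun h => hx (hψ.2.2 h)]
    simp

lemma IsTest.memH1Zero {d : ℕ} {Ω : Set (Sp d)} {ψ : Sp d → ℝ} (hψ : IsTest Ω ψ) :
    MemH1Zero Ω ψ (gradient ψ) :=
  ⟨hψ.memLp _, hψ.memLp_gradient _, fun _ => ψ, fun _ => hψ, by simp, by simp⟩

/-- The set of admissible constants in Friedrichs' inequality. -/
def friedrichsSet {d : ℕ} (Ω : Set (Sp d)) : Set ℝ :=
  {C : ℝ | 0 ≤ C ∧ ∀ (u : Sp d → ℝ) (G : Sp d → Sp d), MemH1Zero Ω u G →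
    eLpNorm u 2 (muO Ω) ≤ ENNReal.ofReal C * eLpNorm G 2 (muO Ω)}

/-- The constant `2R` passes from test functions to the closure. Without this, `sInf ∅ = 0` would be
a junk value; the index `i` encodes `d ≥ 1`. -/
lemma friedrichsSet_nonempty {d : ℕ} (i : Fin d) {Ω : Set (Sp d)}
    (hΩb : Bornology.IsBounded Ω) : (friedrichsSet Ω).Nonempty := by
  obtain ⟨R, hR0, hR⟩ := hΩb.exists_pos_norm_le
  refine ⟨2 * R, by positivity, fun u G hu => ?_⟩
  obtain ⟨φ, hφ, h1, h2⟩ := hu.approx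
  refine le_of_tendsto_of_tendsto' (tendsto_eLpNorm_two (fun n => (hφ n).memLp _) hu.memLp h1)
    (ENNReal.Tendsto.const_mul
      (tendsto_eLpNorm_two (fun n => (hφ n).memLp_gradient _) hu.grad_memLp h2)
      (Or.inr ENNReal.ofReal_ne_top)) fun n => (hφ n).eLpNorm_le i hR0.le hR

/-- The infimum is attained: for fixed `u` with finite `‖G‖`, the inequality is closed in `C`. -/
lemma friedrichsConst_mem {d : ℕ} (i : Fin d) {Ω : Set (Sp d)}
    (hΩb : Bornology.IsBounded Ω) : friedrichsConst Ω ∈ friedrichsSet Ω := by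
  refine ⟨Real.sInf_nonneg fun C hC => hC.1, fun u G hu => ?_⟩
  obtain ⟨C, -, hC, hCm⟩ := exists_seq_tendsto_sInf (friedrichsSet_nonempty i hΩb)
    ⟨0, fun C hC => hC.1⟩
  exact ge_of_tendsto' (ENNReal.Tendsto.mul_const (ENNReal.tendsto_ofReal hC)
    (Or.inr hu.grad_memLp.2.ne)) fun n => (hCm n).2 u G hu

/-- A zero constant would annihilate every test function, against the existence of a bump.
Positivity matters because `0 * ⊤ = 0` in `ℝ≥0∞`. -/
lemma friedrichsConst_pos {d : ℕ} (i : Fin d) {Ω : Set (Sp d)} (hΩ : IsOpen Ω)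
    (hΩb : Bornology.IsBounded Ω) (hne : Ω.Nonempty) : 0 < friedrichsConst Ω := by
  have hm := friedrichsConst_mem i hΩb
  refine hm.1.lt_of_ne fun h0 => ?_
  obtain ⟨x, hx⟩ := hne
  obtain ⟨ψ, h1, h2, h3, -, h5⟩ := exists_contDiff_tsupport_subset (n := ⊤) (hΩ.mem_nhds hx)
  have hψ : IsTest Ω ψ := ⟨h3, h2, h1⟩
  have h := hm.2 _ _ hψ.memH1Zero
  rw [← h0, ENNReal.ofReal_zero, zero_mul, nonpos_iff_eq_zero,
    eLpNorm_eq_zero_iff (hψ.memLp _).1 two_ne_zero] at h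
  have := Measure.eqOn_open_of_ae_eq h hΩ h3.continuous.continuousOn continuousOn_const hx
  rw [h5] at this
  exact one_ne_zero this

/-! ### Test functions on the cylinder -/

lemma IsTest.slice {d : ℕ} {Ω : Set (Sp d)} {φ : Sp d × ℝ → ℝ} (hφ : IsTest (Ω ×ˢ univ) φ)
    (t : ℝ) : IsTest Ω (fun x => φ (x, t)) := by
  have hsub : tsupport (fun x => φ (x, t)) ⊆ (fun x => (x, t)) ⁻¹' tsupport φ :=
    tsupport_comp_subset_preimage φ (by fun_prop)
  refine ⟨hφ.1.comp (by fun_prop), ?_, fun x hx => (hφ.2.2 (hsub hx)).1⟩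
  refine (hφ.2.1.isCompact.image continuous_fst).of_isClosed_subset (isClosed_tsupport _) ?_
  exact fun x hx => ⟨(x, t), hsub hx, rfl⟩

/-- Passing to the full derivative gives joint continuity, support and linearity in `φ` of the
slicewise gradient. -/
lemma gradX_eq {d : ℕ} {φ : Sp d × ℝ → ℝ} (hφ : Differentiable ℝ φ) : gradX φ = fun z =>
    (InnerProductSpace.toDual ℝ (Sp d)).symm
      ((fderiv ℝ φ z).comp (ContinuousLinearMap.inl ℝ (Sp d) ℝ)) := by
  funext z
  have h : HasFDerivAt (fun x : Sp d => φ (x, z.2))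
      ((fderiv ℝ φ z).comp (ContinuousLinearMap.inl ℝ (Sp d) ℝ)) z.1 :=
    (hφ z).hasFDerivAt.comp z.1 (hasFDerivAt_prodMk_left z.1 z.2)
  simp only [gradX, gradient_eq, h.fderiv]

lemma IsTest.continuous_gradX {d : ℕ} {U : Set (Sp d × ℝ)} {φ : Sp d × ℝ → ℝ} (hφ : IsTest U φ) :
    Continuous (gradX φ) := by
  rw [gradX_eq (hφ.1.differentiable (by simp))]
  have := hφ.1.continuous_fderiv (by simp)
  exact (LinearIsometryEquiv.continuous _).comp (this.clm_comp continuous_const)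

lemma IsTest.memLp_gradX {d : ℕ} {U : Set (Sp d × ℝ)} {φ : Sp d × ℝ → ℝ} (hφ : IsTest U φ)
    (μ : Measure (Sp d × ℝ)) [IsFiniteMeasureOnCompacts μ] : MemLp (gradX φ) 2 μ := by
  refine hφ.continuous_gradX.memLp_of_hasCompactSupport ?_
  refine (hφ.2.1.fderiv ℝ).mono fun z hz h0 => hz ?_
  rw [gradX_eq (hφ.1.differentiable (by simp))]
  simp only [h0, ContinuousLinearMap.zero_comp, map_zero]

/-- Friedrichs' inequality on the cylinder, for test functions. -/
lemma IsTest.eLpNorm_muQ_le {d : ℕ} (i : Fin d) {Ω : Set (Sp d)}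
    (hΩb : Bornology.IsBounded Ω) (T : ℝ) {φ : Sp d × ℝ → ℝ} (hφ : IsTest (Ω ×ˢ univ) φ) :
    eLpNorm φ 2 (muQ Ω T)
      ≤ ENNReal.ofReal (friedrichsConst Ω) * eLpNorm (gradX φ) 2 (muQ Ω T) := by
  have hm := friedrichsConst_mem i hΩb
  -- Squaring allows Tonelli, which reduces the claim to Friedrichs' inequality on each time slice.
  rw [← ENNReal.pow_le_pow_left_iff two_ne_zero, mul_pow, eLpNorm_two_sq, eLpNorm_two_sq,
    muQ_eq_prod,
    lintegral_prod_symm _ (hφ.1.continuous.enorm.measurable.pow_const 2).aemeasurable,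
    lintegral_prod_symm _ (hφ.continuous_gradX.enorm.measurable.pow_const 2).aemeasurable,
    ← lintegral_const_mul' _ _ (by finiteness)]
  refine lintegral_mono fun t => ?_
  have h := hm.2 _ _ (hφ.slice t).memH1Zero
  have h2 : eLpNorm (fun x => φ (x, t)) 2 (muO Ω) ^ 2 ≤ (ENNReal.ofReal (friedrichsConst Ω)
    * eLpNorm (gradient fun x => φ (x, t)) 2 (muO Ω)) ^ 2 := by gcongr
  rwa [mul_pow, eLpNorm_two_sq, eLpNorm_two_sq] at h2

/-- Friedrichs' inequality on the cylinder. -/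
lemma MemH10Zero.eLpNorm_le {d : ℕ} (i : Fin d) {Ω : Set (Sp d)}
    (hΩb : Bornology.IsBounded Ω) {T : ℝ} {u : Sp d × ℝ → ℝ} {G : Sp d × ℝ → Sp d}
    (hu : MemH10Zero Ω T u G) :
    eLpNorm u 2 (muQ Ω T) ≤ ENNReal.ofReal (friedrichsConst Ω) * eLpNorm G 2 (muQ Ω T) := by
  obtain ⟨φ, hφ, h1, h2⟩ := hu.approx
  exact le_of_tendsto_of_tendsto' (tendsto_eLpNorm_two (fun n => (hφ n).memLp _) hu.memLp h1)
    (ENNReal.Tendsto.const_mul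
      (tendsto_eLpNorm_two (fun n => (hφ n).memLp_gradX _) hu.grad_memLp h2)
      (Or.inr ENNReal.ofReal_ne_top)) fun n => (hφ n).eLpNorm_muQ_le i hΩb T

/-! ### Green's formula and differences in `H^{1,0}_0(Q)`. -/

/-- Integration by parts in space against a function that vanishes on the lateral surface. -/
lemma MemHdiv.integral_mul_eq {d : ℕ} {Ω : Set (Sp d)} {T : ℝ} {ρ : Sp d × ℝ → Sp d}
    {δ : Sp d × ℝ → ℝ} (hρ : MemHdiv Ω T ρ δ) (hδ : MemLp δ 2 (muQ Ω T)) {u : Sp d × ℝ → ℝ}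
    {G : Sp d × ℝ → Sp d} (hu : MemH10Zero Ω T u G) :
    ∫ z, δ z * u z ∂(muQ Ω T) = -∫ z, inner ℝ (ρ z) (G z) ∂(muQ Ω T) := by
  obtain ⟨φ, hφ, h1, h2⟩ := hu.approx
  -- For test functions, apply the weak divergence on almost every time slice; `δ ∈ L²(Q)` justifies
  -- Fubini and the later limit.
  have htest : ∀ n, ∫ z, inner ℝ (δ z) (φ n z) ∂(muQ Ω T)
      = -∫ z, inner ℝ (ρ z) (gradX (φ n) z) ∂(muQ Ω T) := by
    intro n
    have i1 := integrable_inner_of_memLp hδ ((hφ n).memLp _)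
    have i2 := integrable_inner_of_memLp hρ.memLp ((hφ n).memLp_gradX _)
    rw [muQ_eq_prod] at i1 i2 ⊢
    rw [integral_prod_symm _ i1, integral_prod_symm _ i2, ← integral_neg]
    refine integral_congr_ae ?_
    filter_upwards [hρ.weak_div] with t ht
    have h := ht.2 _ ((hφ n).slice t)
    simp only [gradX]
    rw [← h]
    simp only [real_inner_eq_mul]
  have l1 := tendsto_integral_inner (fun n => (hφ n).memLp _) hu.memLp hδ h1
  have l2 := (tendsto_integral_inner (fun n => (hφ n).memLp_gradX _) hu.grad_memLp hρ.memLp h2).neg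
  have h := tendsto_nhds_unique (l1.congr htest) l2
  rw [← h]
  simp only [real_inner_eq_mul]

lemma MemH10Zero.sub {d : ℕ} {Ω : Set (Sp d)} {T : ℝ} {u v : Sp d × ℝ → ℝ}
    {G H : Sp d × ℝ → Sp d} (hu : MemH10Zero Ω T u G) (hv : MemH10Zero Ω T v H) :
    MemH10Zero Ω T (fun z => u z - v z) (fun z => G z - H z) := by
  refine ⟨⟨hu.memLp.sub hv.memLp, hu.grad_memLp.sub hv.grad_memLp, fun φ hφ => ?_⟩, ?_⟩
  · have hs : ∀ {f : Sp d × ℝ → ℝ} {g : Sp d × ℝ → Sp d}, MemLp f 2 (muQ Ω T) →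
        MemLp g 2 (muQ Ω T) → Integrable (fun z => f z • g z) (muQ Ω T) := fun hf hg =>
      memLp_one_iff_integrable.1 (hg.smul hf)
    have hg := hφ.memLp_gradX (muQ Ω T)
    have hl := hφ.memLp (muQ Ω T)
    simp only [sub_smul, smul_sub]
    rw [integral_sub (hs hu.memLp hg) (hs hv.memLp hg),
      integral_sub (hs hl hu.grad_memLp) (hs hl hv.grad_memLp), hu.weak_grad φ hφ,
      hv.weak_grad φ hφ]
    abel
  · obtain ⟨φ, hφ, h1, h2⟩ := hu.approx
    obtain ⟨χ, hχ, h3, h4⟩ := hv.approx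
    have hgs : ∀ n, gradX (fun z => φ n z - χ n z) = fun z => gradX (φ n) z - gradX (χ n) z := by
      intro n
      have d1 : Differentiable ℝ (φ n) := (hφ n).1.differentiable (by simp)
      have d2 : Differentiable ℝ (χ n) := (hχ n).1.differentiable (by simp)
      rw [gradX_eq (d1.fun_sub d2), gradX_eq d1, gradX_eq d2]
      funext z
      rw [fderiv_fun_sub (d1 z) (d2 z), ContinuousLinearMap.sub_comp, map_sub]
    have hlim : ∀ {E : Type} [NormedAddCommGroup E] {f g : ℕ → Sp d × ℝ → E}
        {f' g' : Sp d × ℝ → E}, (∀ n, MemLp (f n) 2 (muQ Ω T)) → (∀ n, MemLp (g n) 2 (muQ Ω T)) →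
        MemLp f' 2 (muQ Ω T) → MemLp g' 2 (muQ Ω T) →
        Tendsto (fun n => eLpNorm (fun z => f n z - f' z) 2 (muQ Ω T)) atTop (𝓝 0) →
        Tendsto (fun n => eLpNorm (fun z => g n z - g' z) 2 (muQ Ω T)) atTop (𝓝 0) →
        Tendsto (fun n => eLpNorm (fun z => (f n z - g n z) - (f' z - g' z)) 2 (muQ Ω T))
          atTop (𝓝 0) := by
      intro E _ f g f' g' mf mg mf' mg' hf hg
      have hadd := hf.add hg
      rw [add_zero] at hadd
      refine tendsto_of_tendsto_of_tendsto_of_le_of_le tendsto_const_nhds hadd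
        (fun n => zero_le) fun n => ?_
      have e : (fun z => (f n z - g n z) - (f' z - g' z))
          = (fun z => f n z - f' z) - fun z => g n z - g' z := by
        funext z; simp only [Pi.sub_apply]; abel
      rw [e]
      exact eLpNorm_sub_le ((mf n).sub mf').1 ((mg n).sub mg').1 (by norm_num)
    refine ⟨fun n z => φ n z - χ n z, fun n => ⟨(hφ n).1.sub (hχ n).1, (hφ n).2.1.sub (hχ n).2.1,
      (tsupport_sub _ _).trans (union_subset (hφ n).2.2 (hχ n).2.2)⟩, ?_, ?_⟩
    · exact hlim (fun n => (hφ n).memLp _) (fun n => (hχ n).memLp _) hu.memLp hv.memLp h1 h3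
    · simp only [hgs]
      exact hlim (fun n => (hφ n).memLp_gradX _) (fun n => (hχ n).memLp_gradX _) hu.grad_memLp
        hv.grad_memLp h2 h4

/-! ### The energy estimate. -/

/-- The case `R₃ ∈ L^2(Q)` of the estimate, with the sharper constant `1 / ν_low`. -/
lemma eLpNorm_grad_sub_le {d : ℕ} (i : Fin d) {Ω : Set (Sp d)} (hΩ : IsOpen Ω)
    (hΩb : Bornology.IsBounded Ω) {T : ℝ} (hT : 0 < T) {σ ν : Sp d → ℝ}
    (hσm : AEMeasurable σ (muO Ω)) (hνm : AEMeasurable ν (muO Ω)) {σup νlow νup : ℝ}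
    (hνlow : 0 < νlow) (hσ : ∀ x ∈ Ω, |σ x| ≤ σup) (hν : ∀ x ∈ Ω, νlow ≤ ν x ∧ ν x ≤ νup)
    {yd η : Sp d × ℝ → ℝ} (hyd : MemLp yd 2 (muQ Ω T)) (hη : MemLp η 2 (muQ Ω T))
    {p : Sp d × ℝ → ℝ} {Gp : Sp d × ℝ → Sp d}
    (hp : SolvesAdjoint Ω T σ ν (fun q => η q - yd q) p Gp)
    {ζ : Sp d × ℝ → ℝ} {Gζ : Sp d × ℝ → Sp d} {Dζ : Sp d × ℝ → ℝ}
    (hζ : MemH11ZeroPer Ω T ζ Gζ Dζ) {ρ : Sp d × ℝ → Sp d} {δ : Sp d × ℝ → ℝ}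
    (hρ : MemHdiv Ω T ρ δ) (hR3 : MemLp (resR3 σ yd η δ Dζ) 2 (muQ Ω T)) :
    eLpNorm (fun q => Gp q - Gζ q) 2 (muQ Ω T) ≤ ENNReal.ofReal (1 / νlow) *
      (ENNReal.ofReal (friedrichsConst Ω) * eLpNorm (resR3 σ yd η δ Dζ) 2 (muQ Ω T)
        + eLpNorm (resR4 ν ρ Gζ) 2 (muQ Ω T)) := by
  obtain ⟨hp1, hpz⟩ := hp
  obtain ⟨hζ1, hζ2⟩ := hζ
  have he : MemH10Zero Ω T (fun q => p q - ζ q) (fun q => Gp q - Gζ q) := hp1.toMemH10Zero.sub hζ1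
  have heh : MemH1HalfZeroPer Ω T (fun q => p q - ζ q) (fun q => Gp q - Gζ q) :=
    ⟨he, half_finite_sub hT hp1.memLp hζ1.memLp hp1.half_finite
      (hζ2.half_finite hΩ hΩb hT)⟩
  have hfst : ∀ {P : Sp d → Prop}, (∀ x ∈ Ω, P x) → ∀ᵐ z ∂(muQ Ω T), P z.1 := fun h =>
    (ae_restrict_mem (hΩ.measurableSet.prod measurableSet_Ioo)).mono fun z hz => h _ hz.1
  have hσQ : AEStronglyMeasurable (fun z : Sp d × ℝ => σ z.1) (muQ Ω T) := by
    rw [muQ_eq_prod]; exact hσm.aestronglyMeasurable.comp_fst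
  have hνQ : AEStronglyMeasurable (fun z : Sp d × ℝ => ν z.1) (muQ Ω T) := by
    rw [muQ_eq_prod]; exact hνm.aestronglyMeasurable.comp_fst
  have hνabs : ∀ᵐ z : Sp d × ℝ ∂(muQ Ω T), |ν z.1| ≤ νup :=
    hfst (P := fun x => |ν x| ≤ νup) fun x hx => by
    rw [abs_of_pos (hνlow.trans_le (hν x hx).1)]; exact (hν x hx).2
  have hσD : MemLp (fun z => σ z.1 * Dζ z) 2 (muQ Ω T) := by
    refine hζ2.deriv_memLp.of_le_mul (c := σup) (hσQ.mul hζ2.deriv_memLp.1) ?_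
    filter_upwards [hfst hσ] with z hz
    rw [norm_mul]
    exact mul_le_mul_of_nonneg_right hz (norm_nonneg _)
  have hνG : ∀ {G : Sp d × ℝ → Sp d}, MemLp G 2 (muQ Ω T) →
      MemLp (fun z => ν z.1 • G z) 2 (muQ Ω T) := fun hG => by
    refine hG.of_le_mul (c := νup) (hνQ.smul hG.1) ?_
    filter_upwards [hνabs] with z hz
    rw [norm_smul]
    exact mul_le_mul_of_nonneg_right hz (norm_nonneg _)
  -- The divergence is only slicewise square integrable by assumption; all other terms of `R₃` are
  -- in `L²(Q)`, so `δ` is too.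
  have hδ : MemLp δ 2 (muQ Ω T) := by
    have h := (hR3.sub (hη.sub hyd)).sub hσD
    refine h.ae_eq (ae_of_all _ fun z => ?_)
    simp only [Pi.sub_apply, resR3]
    ring
  have hR4 : MemLp (resR4 ν ρ Gζ) 2 (muQ Ω T) := hρ.memLp.sub (hνG hζ1.grad_memLp)
  have heL := he.memLp
  have hGe := he.grad_memLp
  have hweak := hpz _ _ heh
  rw [halfPerp_sub_eq_integral hΩ hΩb hT hσm hσ hp1.memLp hζ2] at hweak
  have hdiv := hρ.integral_mul_eq hδ he
  -- Energy identity: the equation tested with `e`, plus the Green identity for `ρ`.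
  have hen : ∫ q, ν q.1 * ‖Gp q - Gζ q‖ ^ 2 ∂(muQ Ω T)
      = ∫ q, inner ℝ (resR3 σ yd η δ Dζ q) (p q - ζ q) ∂(muQ Ω T)
        + ∫ q, inner ℝ (resR4 ν ρ Gζ q) (Gp q - Gζ q) ∂(muQ Ω T) := by
    have e1 : ∫ q, inner ℝ (resR3 σ yd η δ Dζ q) (p q - ζ q) ∂(muQ Ω T)
        = ∫ q, (η q - yd q) * (p q - ζ q) ∂(muQ Ω T) + ∫ q, δ q * (p q - ζ q) ∂(muQ Ω T)
          + ∫ q, σ q.1 * Dζ q * (p q - ζ q) ∂(muQ Ω T) := by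
      have j1 : Integrable (fun q => (η q - yd q) * (p q - ζ q)) (muQ Ω T) :=
        (hη.sub hyd).integrable_mul heL
      have j2 : Integrable (fun q => δ q * (p q - ζ q)) (muQ Ω T) := hδ.integrable_mul heL
      have j3 : Integrable (fun q => σ q.1 * Dζ q * (p q - ζ q)) (muQ Ω T) :=
        hσD.integrable_mul heL
      have j12 : Integrable (fun q => (η q - yd q) * (p q - ζ q) + δ q * (p q - ζ q))
        (muQ Ω T) := j1.add j2
      rw [← integral_add j1 j2, ← integral_add j12 j3]
      refine integral_congr_ae (ae_of_all _ fun q => ?_)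
      simp only [real_inner_eq_mul, resR3]
      ring
    have j4 := integrable_inner_of_memLp hρ.memLp hGe
    have j5 := integrable_inner_of_memLp (hνG hζ1.grad_memLp) hGe
    have j6 := integrable_inner_of_memLp (hνG hp1.grad_memLp) hGe
    have e2 : ∫ q, inner ℝ (resR4 ν ρ Gζ q) (Gp q - Gζ q) ∂(muQ Ω T)
        = ∫ q, inner ℝ (ρ q) (Gp q - Gζ q) ∂(muQ Ω T)
          - ∫ q, inner ℝ (ν q.1 • Gζ q) (Gp q - Gζ q) ∂(muQ Ω T) := by
      rw [← integral_sub j4 j5]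
      simp only [resR4, inner_sub_left]
    have e3 : ∫ q, ν q.1 * ‖Gp q - Gζ q‖ ^ 2 ∂(muQ Ω T)
        = ∫ q, ν q.1 * inner ℝ (Gp q) (Gp q - Gζ q) ∂(muQ Ω T)
          - ∫ q, inner ℝ (ν q.1 • Gζ q) (Gp q - Gζ q) ∂(muQ Ω T) := by
      simp only [← real_inner_smul_left]
      rw [← integral_sub j6 j5]
      refine integral_congr_ae (ae_of_all _ fun q => ?_)
      simp only [real_inner_smul_left]
      rw [← mul_sub, ← inner_sub_left, real_inner_self_eq_norm_sq]
    rw [e1, e2, e3]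
    linarith
  set N := (eLpNorm (fun q => Gp q - Gζ q) 2 (muQ Ω T)).toReal with hN
  set r3 := (eLpNorm (resR3 σ yd η δ Dζ) 2 (muQ Ω T)).toReal with hr3
  set r4 := (eLpNorm (resR4 ν ρ Gζ) 2 (muQ Ω T)).toReal with hr4
  have hC0 : 0 ≤ friedrichsConst Ω := (friedrichsConst_mem i hΩb).1
  have hF : (eLpNorm (fun q => p q - ζ q) 2 (muQ Ω T)).toReal ≤ friedrichsConst Ω * N := by
    have h := ENNReal.toReal_mono (ENNReal.mul_ne_top ENNReal.ofReal_ne_top hGe.2.ne)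
      (he.eLpNorm_le i hΩb)
    rwa [ENNReal.toReal_mul, ENNReal.toReal_ofReal hC0] at h
  have hup : ∫ q, ν q.1 * ‖Gp q - Gζ q‖ ^ 2 ∂(muQ Ω T)
      ≤ (friedrichsConst Ω * r3 + r4) * N := by
    rw [hen]
    have h1 := integral_inner_le hR3 heL
    have h2 := integral_inner_le hR4 hGe
    have h3 : r3 * (eLpNorm (fun q => p q - ζ q) 2 (muQ Ω T)).toReal
        ≤ r3 * (friedrichsConst Ω * N) := mul_le_mul_of_nonneg_left hF ENNReal.toReal_nonneg
    linarith
  have hsq : Integrable (fun q => ‖Gp q - Gζ q‖ ^ 2) (muQ Ω T) :=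
    (memLp_two_iff_integrable_sq_norm hGe.1).1 hGe
  have hlow : νlow * N ^ 2 ≤ ∫ q, ν q.1 * ‖Gp q - Gζ q‖ ^ 2 ∂(muQ Ω T) := by
    rw [hN, ← integral_norm_sq_eq hGe, ← integral_const_mul]
    refine integral_mono_ae (hsq.const_mul _) (hsq.bdd_mul (c := νup) hνQ hνabs) ?_
    filter_upwards [hfst hν] with q hq
    exact mul_le_mul_of_nonneg_right hq.1 (by positivity)
  have hr30 : 0 ≤ r3 := ENNReal.toReal_nonneg
  have hr40 : 0 ≤ r4 := ENNReal.toReal_nonneg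
  have hfinal : N ≤ 1 / νlow * (friedrichsConst Ω * r3 + r4) := by
    -- From `νlow N² ≤ (C_F r₃ + r₄) N` one factor `N` is cancelled, unless it is zero.
    rcases (ENNReal.toReal_nonneg : 0 ≤ N).eq_or_lt with h0 | hpos
    · rw [hN, ← h0]; positivity
    · have h := hlow.trans hup
      rw [sq, ← mul_assoc] at h
      have h' := le_of_mul_le_mul_right h hpos
      rw [one_div, le_inv_mul_iff₀ hνlow]
      exact h'
  rw [← ENNReal.ofReal_toReal hGe.2.ne, ← ENNReal.ofReal_toReal hR3.2.ne,
    ← ENNReal.ofReal_toReal hR4.2.ne, ← ENNReal.ofReal_mul hC0,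
    ← ENNReal.ofReal_add (mul_nonneg hC0 hr30) hr40, ← ENNReal.ofReal_mul (by positivity)]
  exact ENNReal.ofReal_le_ofReal hfinal

end TimePeriodic

/-! ### The majorant with constant `1 / μ₁`. -/

theorem mainTheorem2 {d : ℕ} (hd : d ∈ ({1, 2, 3} : Set ℕ))
    (Ω : Set (EuclideanSpace ℝ (Fin d))) (hΩ : IsOpen Ω) (hΩb : Bornology.IsBounded Ω)
    (T : ℝ) (hT : 0 < T)
    (σ ν : EuclideanSpace ℝ (Fin d) → ℝ)
    (hσm : AEMeasurable σ (volume.restrict Ω)) (hνm : AEMeasurable ν (volume.restrict Ω))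
    (σlow σup νlow νup : ℝ) (hσlow : 0 < σlow) (hνlow : 0 < νlow)
    (hσ : ∀ x ∈ Ω, σlow ≤ σ x ∧ σ x ≤ σup) (hν : ∀ x ∈ Ω, νlow ≤ ν x ∧ ν x ≤ νup)
    (yd : EuclideanSpace ℝ (Fin d) × ℝ → ℝ) (hyd : MemLp yd 2 (TimePeriodic.muQ Ω T))
    -- `η ∈ H^{1,1}_{0,per}(Q)`
    (η : EuclideanSpace ℝ (Fin d) × ℝ → ℝ)
    (Gη : EuclideanSpace ℝ (Fin d) × ℝ → EuclideanSpace ℝ (Fin d))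
    (Dη : EuclideanSpace ℝ (Fin d) × ℝ → ℝ)
    (hη : TimePeriodic.MemH11ZeroPer Ω T η Gη Dη)
    -- `p = p_η` with `∇p = Gp`
    (p : EuclideanSpace ℝ (Fin d) × ℝ → ℝ)
    (Gp : EuclideanSpace ℝ (Fin d) × ℝ → EuclideanSpace ℝ (Fin d))
    (hp : TimePeriodic.SolvesAdjoint Ω T σ ν (fun q => η q - yd q) p Gp)
    -- `ζ ∈ H^{1,1}_{0,per}(Q)` with `∇ζ = Gζ`, `∂_t ζ = Dζ`
    (ζ : EuclideanSpace ℝ (Fin d) × ℝ → ℝ)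
    (Gζ : EuclideanSpace ℝ (Fin d) × ℝ → EuclideanSpace ℝ (Fin d))
    (Dζ : EuclideanSpace ℝ (Fin d) × ℝ → ℝ)
    (hζ : TimePeriodic.MemH11ZeroPer Ω T ζ Gζ Dζ)
    -- `ρ ∈ H(div,Q)` with `∇·ρ = δ`
    (ρ : EuclideanSpace ℝ (Fin d) × ℝ → EuclideanSpace ℝ (Fin d))
    (δ : EuclideanSpace ℝ (Fin d) × ℝ → ℝ)
    (hρ : TimePeriodic.MemHdiv Ω T ρ δ) :
    eLpNorm (fun q => Gp q - Gζ q) 2 (TimePeriodic.muQ Ω T) ≤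
      ENNReal.ofReal (1 / TimePeriodic.muLow νlow σlow) *
        (ENNReal.ofReal (TimePeriodic.friedrichsConst Ω) *
            eLpNorm (TimePeriodic.resR3 σ yd η δ Dζ) 2 (TimePeriodic.muQ Ω T)
          + eLpNorm (TimePeriodic.resR4 ν ρ Gζ) 2 (TimePeriodic.muQ Ω T)) := by
  have i : Fin d := ⟨0, by rcases hd with rfl | rfl | rfl <;> norm_num⟩
  rcases Ω.eq_empty_or_nonempty with rfl | hne
  · simp [TimePeriodic.muQ, TimePeriodic.cyl]
  have hσabs : ∀ x ∈ Ω, |σ x| ≤ σup := fun x hx => by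
    rw [abs_of_pos (hσlow.trans_le (hσ x hx).1)]; exact (hσ x hx).2
  have hmu : 0 < TimePeriodic.muLow νlow σlow :=
    mul_pos (by positivity) (lt_min hνlow hσlow)
  have hmule : TimePeriodic.muLow νlow σlow ≤ νlow := by
    have h1 : 1 / Real.sqrt 2 ≤ 1 := by
      rw [div_le_one (by positivity)]
      exact Real.one_le_sqrt.2 (by norm_num)
    calc 1 / Real.sqrt 2 * min νlow σlow ≤ 1 * νlow :=
          mul_le_mul h1 (min_le_left _ _) (lt_min hνlow hσlow).le zero_le_one
      _ = νlow := one_mul _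
  by_cases hR3 : MemLp (TimePeriodic.resR3 σ yd η δ Dζ) 2 (TimePeriodic.muQ Ω T)
  · refine (TimePeriodic.eLpNorm_grad_sub_le i hΩ hΩb hT hσm hνm hνlow hσabs hν hyd hη.1.memLp hp hζ
      hρ hR3).trans ?_
    gcongr
  · have hmeas : AEStronglyMeasurable (TimePeriodic.resR3 σ yd η δ Dζ) (TimePeriodic.muQ Ω T) := by
      refine ((hη.1.memLp.1.sub hyd.1).add hρ.meas).add (AEStronglyMeasurable.mul ?_
        hζ.2.deriv_memLp.1)
      rw [TimePeriodic.muQ_eq_prod]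
      exact hσm.aestronglyMeasurable.comp_fst
    -- A measurable `R₃` outside `L²` has infinite norm, and positive factors keep the right-hand
    -- side infinite.
    have htop : eLpNorm (TimePeriodic.resR3 σ yd η δ Dζ) 2 (TimePeriodic.muQ Ω T) = ⊤ := by
      by_contra h
      exact hR3 ⟨hmeas, lt_top_iff_ne_top.2 h⟩
    have hC : ENNReal.ofReal (TimePeriodic.friedrichsConst Ω) ≠ 0 :=
      (ENNReal.ofReal_pos.2 (TimePeriodic.friedrichsConst_pos i hΩ hΩb hne)).ne'
    have hM : ENNReal.ofReal (1 / TimePeriodic.muLow νlow σlow) ≠ 0 :=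
      (ENNReal.ofReal_pos.2 (by positivity)).ne'
    rw [htop, ENNReal.mul_top hC, top_add, ENNReal.mul_top hM]
    exact le_top
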